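/- Let $\varphi$ be an even convex continuous function with $\varphi(0)=0$, $\varphi(x)>0$ for $x\ne 0$, $\varphi(x)/x\to 0$ as $x\to 0$, $\varphi(x)/x\to\infty$ as $x\to\infty$, such that $\lim_{x\to0}\varphi(x)/x^2$ exists in $(0,\infty]$, and suppose that $\varphi(t)=t^\zeta/\zeta$ for $t>1$, where $\zeta\ge 2$ (class $C_I$). A random variable $\xi$ is in $\mathrm{Sub}_\varphi(\Omega)$ if for some $a\ge 0$ one has $E e^{\lambda\xi}\le e^{\varphi(a\lambda)}$ for all $\lambda\in\mathbb R$; $\tau_\varphi(\xi)$ is the infimum of such $a$. Let $(B,\rho)$ be a compact metric space with at least two points, and let $X=\{X(t),t\in B\}$ be a separable process with all $X(t)\in\mathrm{Sub}_\varphi(\Omega)$ such that $X(t)=\sum_{k\ge1}a_k(t)\xi_k$, the series converging in mean square for every $t$, where the $\xi_k\in\mathrm{Sub}_\varphi(\Omega)$ are independent. Let $\hat a_k$ be approximations of $a_k$, $\delta_k(t)=|a_k(t)-\hat a_k(t)|$, let $X_N(t)=\sum_{k=1}^N\hat a_k(t)\xi_k$ be the model and $\Delta_N=X-X_N$. Let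 $\sigma$ and $\sigma_N$ be continuous strictly increasing functions on $(0,\infty)$ that tend to $0$ at $0$, with $$\sup_{\rho(t,s)\le h}\tau_\varphi(X(t)-X(s))\le\sigma(h),\qquad \sup_{\rho(t,s)\le h}\tau_\varphi(\Delta_N(t)-\Delta_N(s))\le\sigma_N(h)\qquad(h>0).$$ Let $R=\inf_{s\in B}\sup_{t\in B}\rho(t,s)$, and let $\beta$ be either of the numbers $\sigma(R)$ and $\sigma_N(R)$, where in the first case $\sigma_N$ is assumed to take all values in $(0,\beta)$. Let $N_B(u)$ be the minimal number of closed balls of radius $u$ covering $B$. Let $r:[1,\infty)\to\mathbb R$ be continuous and strictly increasing with $r(u)>0$ for $u>1$ and $t\mapsto r(e^t)$ convex on $t>0$, and suppose $\int_0^\beta r(N_B(\sigma_N^{(-1)}(u)))\,du<\infty$. Put $\gamma_N=\sup_{u\in B}\tau_\varphi(\Delta_N(u))$ and $v=\min\{\beta,\gamma_N\}$. Then for all $p\in(0,1)$ and all $\delta,\nu$ with $$\delta>\frac{\gamma_N^\zeta(1-p)+p\beta^\zeta}{(1-p)v^{\zeta-1}},\qquad 2\exp\left\{-\frac{(\zeta-1)(\delta(1-p))^{\frac{\zeta}{\zeta-1}}}{\zeta\left(\gamma_N^\zeta(1-p)+p\beta^\zeta\right)^{\frac1{\zeta-1}}}\right\}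 r^{(-1)}\!\left(\frac1{\beta p}\int_0^{\beta p}r\big(N_B(\sigma_N^{(-1)}(u))\big)du\right)\le\nu$$ the model $X_N$ approximates $X$ with reliability $1-\nu$ and accuracy $\delta$ in $C(B)$, that is, $P\{\sup_{t\in B}|\Delta_N(t)|>\delta\}\le\nu$. Moreover, if the function $x\mapsto\varphi(|x|^{1/2})$ is convex on $\mathbb R$ (as it is for $\varphi(t)=t^2/\zeta$ on $|t|\le1$, $\varphi(t)=|t|^\zeta/\zeta$ on $|t|>1$), then $$\gamma_N^\zeta\le\left(\sum_{k=1}^N\tau_\varphi^2(\xi_k)\sup_{u\in B}\delta_k^2(u)+\sum_{k=N+1}^\infty\tau_\varphi^2(\xi_k)\sup_{u\in B}a_k^2(u)\right)^{\zeta/2},$$ where the right-hand side may be infinite. (If $\gamma_N=0$, the threshold for $\delta$ is read as $0$.) -/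

import Mathlib

open MeasureTheory ProbabilityTheory Filter Topology
open scoped ENNReal

noncomputable section

namespace PhiSubGaussian

/-- `φ` is an Orlicz N-function. -/
structure IsOrliczNFunction (φ : ℝ → ℝ) : Prop where
  even : ∀ x, φ (-x) = φ x
  convex : ConvexOn ℝ Set.univ φ
  continuous : Continuous φ
  map_zero : φ 0 = 0
  pos : ∀ x, x ≠ 0 → 0 < φ x
  tendsto_zero : Tendsto (fun x => φ x / x) (𝓝[≠] 0) (𝓝 0)
  tendsto_atTop : Tendsto (fun x => φ x / x) atTop atTop

/-- The limit of `φ x / x ^ 2` at `0` exists in `(0, ∞]`. -/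
def AssumptionQ (φ : ℝ → ℝ) : Prop :=
  ∃ c : ℝ≥0∞, 0 < c ∧ Tendsto (fun x => ENNReal.ofReal (φ x / x ^ 2)) (𝓝[≠] 0) (𝓝 c)

/-- The class `C_I` with exponent `ζ ≥ 2`: N-functions satisfying Assumption Q with
`φ t = t ^ ζ / ζ` for `t > 1`. -/
structure IsClassCI (ζ : ℝ) (φ : ℝ → ℝ) : Prop where
  two_le : 2 ≤ ζ
  isOrlicz : IsOrliczNFunction φ
  assumptionQ : AssumptionQ φ
  eq_of_one_lt : ∀ t, 1 < t → φ t = t ^ ζ / ζ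

variable {Ω : Type*} [MeasurableSpace Ω] {B : Type*}

/-- `E exp (l * ξ) ≤ exp (φ (a * l))` for all real `l`. The expectation is taken in `[0, ∞]`, so
that integrability of `exp (l * ξ)` is part of the claim. -/
def PhiBound (φ : ℝ → ℝ) (P : Measure Ω) (ξ : Ω → ℝ) (a : ℝ) : Prop :=
  ∀ l : ℝ, ∫⁻ ω, ENNReal.ofReal (Real.exp (l * ξ ω)) ∂P ≤ ENNReal.ofReal (Real.exp (φ (a * l)))

/-- `ξ` is a `φ`-sub-Gaussian random variable. -/
def IsSubPhi (φ : ℝ → ℝ) (P : Measure Ω) (ξ : Ω → ℝ) : Prop :=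
  Measurable ξ ∧ ∃ a : ℝ, 0 ≤ a ∧ PhiBound φ P ξ a

/-- The `φ`-sub-Gaussian standard `τ_φ(ξ)`. -/
def subPhiStandard (φ : ℝ → ℝ) (P : Measure Ω) (ξ : Ω → ℝ) : ℝ :=
  sInf {a : ℝ | 0 ≤ a ∧ PhiBound φ P ξ a}

/-- Separability of a process: there are a countable dense set `S` and an event of probability one
on which every value `X t` is a limit of values of `X` at points of `S` arbitrarily close to `t`. -/
def IsSeparableProcess [TopologicalSpace B] (P : Measure Ω) (X : B → Ω → ℝ) : Prop :=
  ∃ S : Set B, S.Countable ∧ Dense S ∧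
    ∀ᵐ ω ∂P, ∀ t : B, ∀ U : Set B, IsOpen U → t ∈ U →
      X t ω ∈ closure ((fun s => X s ω) '' (S ∩ U))

/-- `σ` is a continuous increasing function on `(0, ∞)` with limit `0` at `0` and
`sup_{ρ(t, s) ≤ h} τ_φ(Y(t) - Y(s)) ≤ σ(h)` for all `h > 0`. -/
structure IsIncrementModulus [MetricSpace B] (φ : ℝ → ℝ) (P : Measure Ω) (Y : B → Ω → ℝ)
    (σ : ℝ → ℝ) : Prop where
  continuousOn : ContinuousOn σ (Set.Ioi 0)
  strictMonoOn : StrictMonoOn σ (Set.Ioi 0)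
  tendsto_zero : Tendsto σ (𝓝[>] 0) (𝓝 0)
  bound : ∀ h, 0 < h → ∀ t s : B, dist t s ≤ h →
    subPhiStandard φ P (fun ω => Y t ω - Y s ω) ≤ σ h

/-- `inf_s sup_t ρ(t, s)`. -/
def radius (B : Type*) [MetricSpace B] : ℝ := ⨅ s : B, ⨆ t : B, dist t s

/-- The metric massiveness `N_B(u)`: the minimal number of closed balls of radius `u` (with centres
in `B`) that cover `B`. It is finite for `u > 0` when `B` is compact. -/
def massiveness (B : Type*) [MetricSpace B] (u : ℝ) : ℕ :=
  (Metric.coveringNumber u.toNNReal (Set.univ : Set B)).toNat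

/-- The inverse `σ^{(-1)}` of a function considered on `(0, ∞)`. -/
def invPos (σ : ℝ → ℝ) : ℝ → ℝ := Function.invFunOn σ (Set.Ioi 0)

/-- The inverse `r^{(-1)}` of a function considered on `[1, ∞)`. -/
def invOne (r : ℝ → ℝ) : ℝ → ℝ := Function.invFunOn r (Set.Ici 1)

/-- The functions `r` admitted in the entropy integral. -/
structure IsEntropyWeight (r : ℝ → ℝ) : Prop where
  continuousOn : ContinuousOn r (Set.Ici 1)
  strictMonoOn : StrictMonoOn r (Set.Ici 1)
  pos : ∀ u, 1 < u → 0 < r u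
  convexOn : ConvexOn ℝ (Set.Ioi 0) (fun t => r (Real.exp t))

/-- The integrand `u ↦ r (N_B (σ^{(-1)} (u)))`. -/
def entropyIntegrand (B : Type*) [MetricSpace B] (r σ : ℝ → ℝ) (u : ℝ) : ℝ :=
  r (massiveness B (invPos σ u))

/-- The factor `r^{(-1)} ((1 / (β p)) ∫_0^{β p} r (N_B (σ^{(-1)} (u))) du)`. -/
def entropyFactor (B : Type*) [MetricSpace B] (r σ : ℝ → ℝ) (β p : ℝ) : ℝ :=
  invOne r (1 / (β * p) * ∫ u in (0 : ℝ)..(β * p), entropyIntegrand B r σ u)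

/-- `X t = ∑_k a_k(t) ξ_k`, where for every `t` the series converges in mean square.
The terms are indexed from `0`. -/
def IsSeriesExpansion (P : Measure Ω) (X : B → Ω → ℝ) (a : ℕ → B → ℝ) (ξ : ℕ → Ω → ℝ) : Prop :=
  ∀ t, Tendsto (fun n : ℕ =>
    eLpNorm (fun ω => X t ω - ∑ k ∈ Finset.range n, a k t * ξ k ω) 2 P) atTop (𝓝 0)

/-- The model: the sum of the first `N` terms of the series with coefficients `â_k`. -/
def model (ahat : ℕ → B → ℝ) (ξ : ℕ → Ω → ℝ) (N : ℕ) : B → Ω → ℝ :=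
  fun t ω => ∑ k ∈ Finset.range N, ahat k t * ξ k ω

/-- The error process `Δ_N = X - X_N`. -/
def errorProcess (X : B → Ω → ℝ) (ahat : ℕ → B → ℝ) (ξ : ℕ → Ω → ℝ) (N : ℕ) : B → Ω → ℝ :=
  fun t ω => X t ω - model ahat ξ N t ω

/-- `sup_{u ∈ B} τ_φ(Y(u))`. -/
def supStandard (φ : ℝ → ℝ) (P : Measure Ω) (Y : B → Ω → ℝ) : ℝ :=
  ⨆ u : B, subPhiStandard φ P (Y u)

/-- The model `Y` approximates `X` with reliability `1 - ν` and accuracy `δ` in `C(B)`: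
`P {sup_t |X(t) - Y(t)| > δ} ≤ ν`. The supremum may be infinite; it exceeds `δ` exactly if
some value does. -/
def Approximates (P : Measure Ω) (X Y : B → Ω → ℝ) (δ ν : ℝ) : Prop :=
  P {ω | ∃ t, δ < |X t ω - Y t ω|} ≤ ENNReal.ofReal ν

end PhiSubGaussian

end

namespace PhiSubGaussian

/-! ### Exponential-moment bounds, the standard, and independent sums. -/

section Basics

variable {Ω : Type*} [MeasurableSpace Ω] {P : Measure Ω} {φ : ℝ → ℝ} {ξ η : Ω → ℝ} {a b : ℝ}

/-! The tail bound is chaining with weighted Hölder. Write `Y` for the error process. Minimal nets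
`V j` of radius `σN⁻¹(β p^(j+1))` give chain increments of standard at most `β p^j`, preceded by the
value itself, of standard at most `γ`. Hölder with weights `(1-p) p^j` rescales `l` at level `j` to
`l / ((1-p) p^j)`. This cancels `p^j`, so every increment before the last contributes the same `φ(β
l / (1-p))`, and the supremum over the final set costs only the weighted geometric mean of the net
sizes (`measure_exists_lt_abs_le_of_chain`).

Jensen for `r ∘ exp` bounds this geometric mean by the entropy factor, since the weights are
proportional to the lengths of the intervals on which the integrand is compared with its value at
the right end (`exp_sum_log_massiveness_le`). Ending the chain in an arbitrary finite set `F` costs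
`|F|^(p^(m+1))`, which tends to 1 (`measure_exists_mem_finset_le`). Optimising over `l` gives the
stated exponent; the threshold on `δ` keeps both arguments of `φ` above 1, where `φ` is a power
(`tail_exponent_eq`).

Passing from finite sets to `B` needs separability of the error process, while only `X` is assumed
separable. The model is almost surely continuous: its increments have small standard, and
independence transfers this to each coefficient (`isSeparableProcess_errorProcess`).

For the bound on `γ`, convexity of `φ(√|x|)` makes squared standards subadditive over independent
terms, and Fatou passes to the series (`phiBound_errorProcess_of_convexOn`). -/

theorem IsOrliczNFunction.le_of_abs_le (hφ : IsOrliczNFunction φ) {x y : ℝ} (h : |x| ≤ |y|) :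
    φ x ≤ φ y := by
  have hx : x ∈ Set.Icc (-|y|) |y| := abs_le.1 h
  have h1 := hφ.convex.le_max_of_mem_Icc (Set.mem_univ _) (Set.mem_univ _) hx
  have h2 : φ |y| = φ y := by
    rcases abs_choice y with h | h <;> rw [h]
    exact hφ.even y
  rwa [hφ.even, h2, max_self] at h1

theorem IsOrliczNFunction.map_abs_mul (hφ : IsOrliczNFunction φ) (c l : ℝ) :
    φ (|c| * l) = φ (c * l) :=
  le_antisymm (hφ.le_of_abs_le (by simp [abs_mul])) (hφ.le_of_abs_le (by simp [abs_mul]))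

theorem PhiBound.mono (hφ : IsOrliczNFunction φ) (ha : 0 ≤ a) (hab : a ≤ b)
    (h : PhiBound φ P ξ a) : PhiBound φ P ξ b := fun l =>
  (h l).trans <| ENNReal.ofReal_le_ofReal <| Real.exp_le_exp.2 <| hφ.le_of_abs_le <| by
    rw [abs_mul, abs_mul, abs_of_nonneg ha, abs_of_nonneg (ha.trans hab)]
    gcongr

theorem IsOrliczNFunction.continuous_ofReal_exp (hφ : IsOrliczNFunction φ) (l : ℝ) :
    Continuous fun a : ℝ => ENNReal.ofReal (Real.exp (φ (a * l))) :=
  ENNReal.continuous_ofReal.comp <| Real.continuous_exp.comp <|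
    hφ.continuous.comp (continuous_mul_const l)

/-- Closedness makes the infimum defining the standard attained. -/
theorem isClosed_setOf_phiBound (hφ : IsOrliczNFunction φ) :
    IsClosed {a : ℝ | 0 ≤ a ∧ PhiBound φ P ξ a} := by
  simp only [PhiBound, Set.ofPred_and, Set.ofPred_forall]
  exact isClosed_Ici.inter <| isClosed_iInter fun l =>
    isClosed_le continuous_const (hφ.continuous_ofReal_exp l)

theorem subPhiStandard_nonneg : 0 ≤ subPhiStandard φ P ξ :=
  Real.sInf_nonneg fun _ h => h.1

theorem subPhiStandard_le (ha : 0 ≤ a) (h : PhiBound φ P ξ a) : subPhiStandard φ P ξ ≤ a :=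
  csInf_le ⟨0, fun _ h => h.1⟩ ⟨ha, h⟩

theorem IsSubPhi.phiBound (hφ : IsOrliczNFunction φ) (h : IsSubPhi φ P ξ) :
    PhiBound φ P ξ (subPhiStandard φ P ξ) :=
  ((isClosed_setOf_phiBound hφ).csInf_mem h.2 ⟨0, fun _ h => h.1⟩).2

theorem PhiBound.const_mul (hφ : IsOrliczNFunction φ) (h : PhiBound φ P ξ a) (c : ℝ) :
    PhiBound φ P (fun ω => c * ξ ω) (|c| * a) := fun l => by
  have h1 := h (l * c)
  have h2 : φ (|c| * a * l) = φ (a * (l * c)) := by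
    rw [mul_assoc, hφ.map_abs_mul]
    ring_nf
  rw [h2]
  simpa only [mul_assoc] using h1

theorem PhiBound.of_forall_pos (hφ : IsOrliczNFunction φ)
    (h : ∀ ε > 0, PhiBound φ P ξ (a + ε)) : PhiBound φ P ξ a := fun l => by
  have hc : Continuous fun ε : ℝ => ENNReal.ofReal (Real.exp (φ ((a + ε) * l))) :=
    (hφ.continuous_ofReal_exp l).comp (continuous_const_add a)
  have ht : Tendsto (fun ε : ℝ => ENNReal.ofReal (Real.exp (φ ((a + ε) * l)))) (𝓝[>] 0)
      (𝓝 (ENNReal.ofReal (Real.exp (φ (a * l))))) := by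
    have := hc.tendsto 0
    rw [add_zero] at this
    exact this.mono_left nhdsWithin_le_nhds
  exact ge_of_tendsto ht (eventually_mem_nhdsWithin.mono fun ε hε => h ε hε l)

theorem ofReal_exp_rpow (x p : ℝ) :
    ENNReal.ofReal (Real.exp x) ^ p = ENNReal.ofReal (Real.exp (x * p)) := by
  rw [ENNReal.ofReal_rpow_of_pos (Real.exp_pos x), Real.exp_mul]

/-- Hölder with weights `a/(a+b)` and `b/(a+b)`: these make the bounds for both factors equal to
`exp (φ ((a+b) l))`. -/
theorem PhiBound.add_of_pos (hξ : Measurable ξ) (hη : Measurable η) (ha : 0 < a) (hb : 0 < b)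
    (h : PhiBound φ P ξ a) (h' : PhiBound φ P η b) :
    PhiBound φ P (fun ω => ξ ω + η ω) (a + b) := fun l => by
  have hab : a + b ≠ 0 := (add_pos ha hb).ne'
  have hp : a / (a + b) + b / (a + b) = 1 := by field_simp
  have hH := ENNReal.lintegral_mul_norm_pow_le (μ := P)
    (f := fun ω => ENNReal.ofReal (Real.exp ((l * (a + b) / a) * ξ ω)))
    (g := fun ω => ENNReal.ofReal (Real.exp ((l * (a + b) / b) * η ω)))
    (by fun_prop) (by fun_prop) (p := a / (a + b)) (q := b / (a + b)) (by positivity)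
    (by positivity) hp
  calc ∫⁻ ω, ENNReal.ofReal (Real.exp (l * (ξ ω + η ω))) ∂P
      = ∫⁻ ω, ENNReal.ofReal (Real.exp ((l * (a + b) / a) * ξ ω)) ^ (a / (a + b)) *
          ENNReal.ofReal (Real.exp ((l * (a + b) / b) * η ω)) ^ (b / (a + b)) ∂P := by
        refine lintegral_congr fun ω => ?_
        rw [ofReal_exp_rpow, ofReal_exp_rpow, ← ENNReal.ofReal_mul (Real.exp_pos _).le,
          ← Real.exp_add]
        congr 2
        field_simp
    _ ≤ _ := hH
    _ ≤ ENNReal.ofReal (Real.exp (φ ((a + b) * l))) ^ (a / (a + b)) *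
          ENNReal.ofReal (Real.exp (φ ((a + b) * l))) ^ (b / (a + b)) := by
        have h1 := h (l * (a + b) / a)
        have h2 := h' (l * (a + b) / b)
        rw [show a * (l * (a + b) / a) = (a + b) * l by field_simp] at h1
        rw [show b * (l * (a + b) / b) = (a + b) * l by field_simp] at h2
        gcongr
    _ = _ := by
        rw [← ENNReal.rpow_add _ _ (by simp [Real.exp_pos]) ENNReal.ofReal_ne_top, hp,
          ENNReal.rpow_one]

theorem PhiBound.add (hφ : IsOrliczNFunction φ) (hξ : Measurable ξ) (hη : Measurable η)
    (ha : 0 ≤ a) (hb : 0 ≤ b) (h : PhiBound φ P ξ a) (h' : PhiBound φ P η b) :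
    PhiBound φ P (fun ω => ξ ω + η ω) (a + b) :=
  .of_forall_pos hφ fun ε hε => by
    rw [show a + b + ε = (a + ε / 2) + (b + ε / 2) by ring]
    exact .add_of_pos hξ hη (by positivity) (by positivity)
      (h.mono hφ ha (by linarith)) (h'.mono hφ hb (by linarith))

theorem phiBound_zero [IsProbabilityMeasure P] (hφ : IsOrliczNFunction φ) :
    PhiBound φ P (fun _ => 0) 0 := fun l => by
  simp [hφ.map_zero]

theorem IsSubPhi.const_mul (hφ : IsOrliczNFunction φ) (h : IsSubPhi φ P ξ) (c : ℝ) :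
    IsSubPhi φ P (fun ω => c * ξ ω) := by
  obtain ⟨hm, a, ha, hb⟩ := h
  exact ⟨hm.const_mul c, |c| * a, by positivity, hb.const_mul hφ c⟩

theorem IsSubPhi.add (hφ : IsOrliczNFunction φ) (h : IsSubPhi φ P ξ) (h' : IsSubPhi φ P η) :
    IsSubPhi φ P (fun ω => ξ ω + η ω) := by
  obtain ⟨hm, a, ha, hb⟩ := h
  obtain ⟨hm', a', ha', hb'⟩ := h'
  exact ⟨hm.add hm', a + a', by positivity, hb.add hφ hm hm' ha ha' hb'⟩

theorem IsSubPhi.sub (hφ : IsOrliczNFunction φ) (h : IsSubPhi φ P ξ) (h' : IsSubPhi φ P η) :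
    IsSubPhi φ P (fun ω => ξ ω - η ω) := by
  simpa [sub_eq_add_neg] using h.add hφ (h'.const_mul hφ (-1))

theorem IsSubPhi.sum [IsProbabilityMeasure P] (hφ : IsOrliczNFunction φ) {ι : Type*}
    (s : Finset ι) {ξ : ι → Ω → ℝ} (h : ∀ i ∈ s, IsSubPhi φ P (ξ i)) :
    IsSubPhi φ P (fun ω => ∑ i ∈ s, ξ i ω) := by
  classical
  induction s using Finset.induction_on with
  | empty => simpa using ⟨measurable_const, 0, le_rfl, phiBound_zero hφ⟩
  | insert i s hi ih =>
    simp only [Finset.sum_insert hi]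
    exact (h i (by simp)).add hφ (ih fun j hj => h j (by simp [hj]))

theorem subPhiStandard_add_le (hφ : IsOrliczNFunction φ) (h : IsSubPhi φ P ξ)
    (h' : IsSubPhi φ P η) : subPhiStandard φ P (fun ω => ξ ω + η ω) ≤
      subPhiStandard φ P ξ + subPhiStandard φ P η :=
  subPhiStandard_le (add_nonneg subPhiStandard_nonneg subPhiStandard_nonneg)
    ((h.phiBound hφ).add hφ h.1 h'.1 subPhiStandard_nonneg subPhiStandard_nonneg (h'.phiBound hφ))

/-- The bounds at `l = ±1` give `E cosh ξ ≤ 1`, whereas `cosh ≥ 1` with equality only at 0. -/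
theorem PhiBound.ae_eq_zero [IsProbabilityMeasure P] (hφ : IsOrliczNFunction φ)
    (hξ : Measurable ξ) (h : PhiBound φ P ξ 0) : ∀ᵐ ω ∂P, ξ ω = 0 := by
  have hpt : ∀ x : ℝ, 2 ≤ Real.exp x + Real.exp (-x) := fun x => by
    have := Real.one_le_cosh x
    rw [Real.cosh_eq] at this
    linarith
  have h1 := h 1
  have h2 := h (-1)
  simp only [zero_mul, hφ.map_zero, Real.exp_zero, ENNReal.ofReal_one, one_mul, neg_mul] at h1 h2
  have hle : ∫⁻ ω, ENNReal.ofReal (Real.exp (ξ ω) + Real.exp (-ξ ω)) ∂P ≤ ∫⁻ _, 2 ∂P := by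
    simp_rw [ENNReal.ofReal_add (Real.exp_pos _).le (Real.exp_pos _).le]
    rw [lintegral_add_left (by fun_prop), lintegral_const, measure_univ, mul_one]
    calc _ ≤ (1 : ℝ≥0∞) + 1 := add_le_add h1 h2
      _ = 2 := by norm_num
  have := ae_eq_of_ae_le_of_lintegral_le (μ := P) (f := fun _ => (2 : ℝ≥0∞))
    (g := fun ω => ENNReal.ofReal (Real.exp (ξ ω) + Real.exp (-ξ ω)))
    (.of_forall fun ω => by
      rw [show (2 : ℝ≥0∞) = ENNReal.ofReal 2 by simp]
      exact ENNReal.ofReal_le_ofReal (hpt _))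
    (by simp) (by fun_prop) hle
  filter_upwards [this] with ω hω
  by_contra hne
  have hlt := Real.one_lt_cosh.2 hne
  rw [Real.cosh_eq] at hlt
  have h2 : ENNReal.ofReal 2 < ENNReal.ofReal (Real.exp (ξ ω) + Real.exp (-ξ ω)) :=
    ENNReal.ofReal_lt_ofReal_iff_of_nonneg (by norm_num) |>.2 (by linarith)
  rw [← hω] at h2
  simp at h2

theorem PhiBound.integrable_exp (hξ : Measurable ξ) (h : PhiBound φ P ξ a) (l : ℝ) :
    Integrable (fun ω => Real.exp (l * ξ ω)) P := by
  refine ⟨by fun_prop, ?_⟩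
  rw [hasFiniteIntegral_iff_ofReal (.of_forall fun ω => (Real.exp_pos _).le)]
  exact (h l).trans_lt ENNReal.ofReal_lt_top

theorem PhiBound.integral_exp_le (hξ : Measurable ξ) (h : PhiBound φ P ξ a) (l : ℝ) :
    ∫ ω, Real.exp (l * ξ ω) ∂P ≤ Real.exp (φ (a * l)) := by
  rw [integral_eq_lintegral_of_nonneg_ae (.of_forall fun ω => (Real.exp_pos _).le) (by fun_prop)]
  exact ENNReal.toReal_le_of_le_ofReal (Real.exp_pos _).le (h l)

theorem PhiBound.integrable (hξ : Measurable ξ) (h : PhiBound φ P ξ a) : Integrable ξ P := by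
  refine ((h.integrable_exp hξ 1).add (h.integrable_exp hξ (-1))).mono' (by fun_prop)
    (.of_forall fun ω => ?_)
  simp only [one_mul, neg_mul, Pi.add_apply, Real.norm_eq_abs]
  have h1 := Real.add_one_le_exp (ξ ω)
  have h2 := Real.add_one_le_exp (-ξ ω)
  have h3 := Real.exp_pos (ξ ω)
  have h4 := Real.exp_pos (-ξ ω)
  rw [abs_le]
  constructor <;> linarith

theorem IsOrliczNFunction.hasDerivAt_zero (hφ : IsOrliczNFunction φ) : HasDerivAt φ 0 0 := by
  rw [hasDerivAt_iff_tendsto_slope]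
  refine hφ.tendsto_zero.congr fun x => ?_
  simp [slope_def_field, hφ.map_zero]

/-- With `m` the mean, `exp (φ (a l)) - 1 - l m` is nonnegative and vanishes at `l = 0`. Its
derivative there is `-m`, because `φ x / x → 0` means `φ' 0 = 0`. -/
theorem PhiBound.integral_eq_zero [IsProbabilityMeasure P] (hφ : IsOrliczNFunction φ)
    (hξ : Measurable ξ) (h : PhiBound φ P ξ a) : ∫ ω, ξ ω ∂P = 0 := by
  set m := ∫ ω, ξ ω ∂P with hm
  have hge : ∀ l : ℝ, 0 ≤ Real.exp (φ (a * l)) - 1 - l * m := fun l => by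
    have h1 : ∫ ω, (l * ξ ω + 1) ∂P ≤ ∫ ω, Real.exp (l * ξ ω) ∂P :=
      integral_mono (((h.integrable hξ).const_mul l).add (integrable_const 1))
        (h.integrable_exp hξ l) fun ω => Real.add_one_le_exp _
    rw [integral_add ((h.integrable hξ).const_mul l) (integrable_const 1),
      integral_const_mul, integral_const, probReal_univ, one_smul] at h1
    have := h.integral_exp_le hξ l
    linarith
  have hd : HasDerivAt (fun l : ℝ => Real.exp (φ (a * l)) - 1 - l * m) (-m) 0 := by
    have h0 : HasDerivAt φ 0 (a * 0) := by simpa using hφ.hasDerivAt_zero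
    have h1 := ((h0.comp (0 : ℝ) ((hasDerivAt_id (0 : ℝ)).const_mul a)).exp.sub_const 1).sub
      ((hasDerivAt_id (0 : ℝ)).mul_const m)
    have h2 : -m = Real.exp ((φ ∘ HMul.hMul a) 0) * (0 * (a * 1)) - 1 * m := by simp
    rw [h2]
    exact h1
  have hmin : IsLocalMin (fun l : ℝ => Real.exp (φ (a * l)) - 1 - l * m) 0 :=
    .of_forall fun l => by simpa [hφ.map_zero] using hge l
  simpa using hmin.hasDerivAt_eq_zero hd

theorem IsSubPhi.one_le_lintegral_exp [IsProbabilityMeasure P] (hφ : IsOrliczNFunction φ)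
    (h : IsSubPhi φ P ξ) (l : ℝ) : 1 ≤ ∫⁻ ω, ENNReal.ofReal (Real.exp (l * ξ ω)) ∂P := by
  obtain ⟨hξ, a, -, ha⟩ := h
  rw [← ofReal_integral_eq_lintegral_ofReal (ha.integrable_exp hξ l)
    (.of_forall fun ω => (Real.exp_pos _).le), ENNReal.one_le_ofReal]
  have h1 : ∫ ω, (l * ξ ω + 1) ∂P ≤ ∫ ω, Real.exp (l * ξ ω) ∂P :=
    integral_mono (((ha.integrable hξ).const_mul l).add (integrable_const 1))
      (ha.integrable_exp hξ l) fun ω => Real.add_one_le_exp _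
  rwa [integral_add ((ha.integrable hξ).const_mul l) (integrable_const 1),
    integral_const_mul, ha.integral_eq_zero hφ hξ, integral_const, probReal_univ, one_smul,
    mul_zero, zero_add] at h1

theorem lintegral_exp_sum_eq_prod {ι : Type*} {ξ : ι → Ω → ℝ} (hξ : ∀ i, Measurable (ξ i))
    (hind : iIndepFun ξ P) (s : Finset ι) (c : ι → ℝ) (l : ℝ) :
    ∫⁻ ω, ENNReal.ofReal (Real.exp (l * ∑ i ∈ s, c i * ξ i ω)) ∂P =
      ∏ i ∈ s, ∫⁻ ω, ENNReal.ofReal (Real.exp (l * (c i * ξ i ω))) ∂P := by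
  rw [← lintegral_prod_eq_prod_lintegral_of_indepFun s
    (fun i ω => ENNReal.ofReal (Real.exp (l * (c i * ξ i ω))))
    (hind.comp (fun i x => ENNReal.ofReal (Real.exp (l * (c i * x)))) fun i => by fun_prop)
    fun i => by have := hξ i; fun_prop]
  refine lintegral_congr fun ω => ?_
  rw [Finset.mul_sum, Real.exp_sum, ENNReal.ofReal_prod_of_nonneg fun i _ => (Real.exp_pos _).le]

/-- Dropping terms of a sum of independent centred variables does not increase the standard. -/
theorem PhiBound.of_sum [IsProbabilityMeasure P] (hφ : IsOrliczNFunction φ) {ι : Type*}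
    {ξ : ι → Ω → ℝ} (hξ : ∀ i, IsSubPhi φ P (ξ i)) (hind : iIndepFun ξ P) {s : Finset ι}
    {c : ι → ℝ} (h : PhiBound φ P (fun ω => ∑ i ∈ s, c i * ξ i ω) a) {k : ι} (hk : k ∈ s) :
    PhiBound φ P (fun ω => c k * ξ k ω) a := fun l => by
  refine le_trans ?_ (h l)
  -- By independence the moment is a product, and centredness makes every factor at least 1.
  rw [lintegral_exp_sum_eq_prod (fun i => (hξ i).1) hind]
  exact Finset.single_le_prod' (f := fun i => ∫⁻ ω, ENNReal.ofReal (Real.exp (l * (c i * ξ i ω))) ∂P)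
    (fun i _ => ((hξ i).const_mul hφ (c i)).one_le_lintegral_exp hφ l) hk

end Basics

/-! ### Covering numbers and the entropy factor. -/

section Entropy

variable {B : Type*} [MetricSpace B] {σ r : ℝ → ℝ} {β p : ℝ}

theorem coveringNumber_univ_ne_top [CompactSpace B] {ε : NNReal} (hε : ε ≠ 0) :
    Metric.coveringNumber ε (Set.univ : Set B) ≠ ⊤ := by
  obtain ⟨C, hC, hfin, hcov⟩ := Metric.exists_finite_isCover_of_isCompact hε
    (isCompact_univ (X := B))
  exact ne_top_of_le_ne_top hfin.encard_lt_top.ne (hcov.coveringNumber_le_encard hC)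

theorem exists_net_card_eq_massiveness [CompactSpace B] {u : ℝ} (hu : 0 < u) :
    ∃ V : Finset B, V.card = massiveness B u ∧ ∀ t, ∃ s ∈ V, dist t s ≤ u := by
  obtain ⟨C, -, hfin, hcov, hcard⟩ := Metric.exists_set_encard_eq_coveringNumber
    (coveringNumber_univ_ne_top (B := B) (Real.toNNReal_pos.2 hu).ne')
  refine ⟨hfin.toFinset, ?_, fun t => ?_⟩
  · rw [massiveness, ← hcard, hfin.encard_eq_coe_toFinset_card, ENat.toNat_natCast]
  · have := Metric.isCover_iff_subset_iUnion_closedBall.1 hcov (Set.mem_univ t)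
    simpa [Real.coe_toNNReal _ hu.le] using this

theorem massiveness_anti [CompactSpace B] {u v : ℝ} (hu : 0 < u) (huv : u ≤ v) :
    massiveness B v ≤ massiveness B u :=
  ENat.toNat_le_toNat (Metric.coveringNumber_anti (Real.toNNReal_le_toNNReal huv))
    (coveringNumber_univ_ne_top (Real.toNNReal_pos.2 hu).ne')

theorem one_le_massiveness [CompactSpace B] [Nonempty B] {u : ℝ} (hu : 0 < u) :
    1 ≤ massiveness B u := by
  obtain ⟨V, hV, hcov⟩ := exists_net_card_eq_massiveness (B := B) hu
  obtain ⟨s, hs, -⟩ := hcov (Classical.arbitrary B)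
  rw [← hV]
  exact Finset.card_pos.2 ⟨s, hs⟩

theorem invPos_pos {u : ℝ} (hu : u ∈ σ '' Set.Ioi 0) : 0 < invPos σ u :=
  Function.invFunOn_mem hu

theorem map_invPos {u : ℝ} (hu : u ∈ σ '' Set.Ioi 0) : σ (invPos σ u) = u :=
  Function.invFunOn_eq hu

theorem invPos_le_invPos (hσ : StrictMonoOn σ (Set.Ioi 0)) {u v : ℝ} (hu : u ∈ σ '' Set.Ioi 0)
    (hv : v ∈ σ '' Set.Ioi 0) (huv : u ≤ v) : invPos σ u ≤ invPos σ v := by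
  rwa [← hσ.le_iff_le (invPos_pos hu) (invPos_pos hv), map_invPos hu, map_invPos hv]

theorem entropyIntegrand_anti [CompactSpace B] [Nonempty B] (hσ : StrictMonoOn σ (Set.Ioi 0))
    (hr : IsEntropyWeight r) {u v : ℝ} (hu : u ∈ σ '' Set.Ioi 0)
    (hv : v ∈ σ '' Set.Ioi 0) (huv : u ≤ v) :
    entropyIntegrand B r σ v ≤ entropyIntegrand B r σ u := by
  have h1 := one_le_massiveness (B := B) (invPos_pos hu)
  have h2 := one_le_massiveness (B := B) (invPos_pos hv)
  refine hr.strictMonoOn.monotoneOn (by simpa using h2) (by simpa using h1) ?_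
  exact_mod_cast massiveness_anti (invPos_pos hu) (invPos_le_invPos hσ hu hv huv)

theorem le_entropyIntegrand [CompactSpace B] [Nonempty B] (hr : IsEntropyWeight r) {u : ℝ}
    (hu : u ∈ σ '' Set.Ioi 0) : r 1 ≤ entropyIntegrand B r σ u := by
  have h1 := one_le_massiveness (B := B) (invPos_pos hu)
  exact hr.strictMonoOn.monotoneOn (by simp) (by simpa using h1) (by exact_mod_cast h1)

theorem IsEntropyWeight.tendsto_exp_add (hr : IsEntropyWeight r) {x : ℝ} (hx : 0 ≤ x) :
    Tendsto (fun ε : ℝ => r (Real.exp (x + ε))) (𝓝[>] 0) (𝓝 (r (Real.exp x))) := by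
  have h1 : ContinuousWithinAt r (Set.Ici 1) (Real.exp x) :=
    hr.continuousOn _ (by simpa using hx)
  refine h1.tendsto.comp (tendsto_nhdsWithin_iff.2 ⟨?_, ?_⟩)
  · have h2 : Continuous fun ε : ℝ => Real.exp (x + ε) := by fun_prop
    have := h2.tendsto 0
    rw [add_zero] at this
    exact this.mono_left nhdsWithin_le_nhds
  · filter_upwards [self_mem_nhdsWithin] with ε hε
    simpa using add_nonneg hx (le_of_lt hε)

/-- Jensen's inequality for an entropy weight, in multiplicative form. -/
theorem IsEntropyWeight.map_exp_sum_le (hr : IsEntropyWeight r) {ι : Type*} (s : Finset ι)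
    {w x : ι → ℝ} (hw : ∀ i ∈ s, 0 ≤ w i) (hw1 : ∑ i ∈ s, w i = 1) (hx : ∀ i ∈ s, 0 ≤ x i) :
    r (Real.exp (∑ i ∈ s, w i * x i)) ≤ ∑ i ∈ s, w i * r (Real.exp (x i)) := by
  -- Convexity is known only on the open half-line and some `x i` may be 0, so all points are
  -- shifted by `ε → 0+`.
  refine le_of_tendsto_of_tendsto
    (hr.tendsto_exp_add (Finset.sum_nonneg fun i hi => mul_nonneg (hw i hi) (hx i hi)))
    (tendsto_finsetSum s fun i hi => (hr.tendsto_exp_add (hx i hi)).const_mul (w i)) ?_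
  filter_upwards [self_mem_nhdsWithin] with ε hε
  have := hr.convexOn.map_sum_le hw hw1 (p := fun i => x i + ε)
    fun i hi => add_pos_of_nonneg_of_pos (hx i hi) hε
  simpa [mul_add, Finset.sum_add_distrib, ← Finset.sum_mul, hw1] using this

/-- `invOne r` is a true inverse only on the range of `r`. The range contains `[r 1, ∞)`: a convex,
strictly increasing `r ∘ exp` grows at least linearly. -/
theorem IsEntropyWeight.exists_eq (hr : IsEntropyWeight r) {y : ℝ} (hy : r 1 ≤ y) :
    y ∈ r '' Set.Ici 1 := by
  have hlt : r (Real.exp 1) < r (Real.exp 2) :=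
    hr.strictMonoOn (by simp) (by simp) (by simp)
  set d := r (Real.exp 2) - r (Real.exp 1) with hd
  have hd0 : 0 < d := sub_pos.2 hlt
  have hgrow : ∀ t : ℝ, 2 < t → r (Real.exp 2) + (t - 2) * d ≤ r (Real.exp t) := fun t ht => by
    have := hr.convexOn.slope_mono_adjacent (x := 1) (y := 2) (z := t) (by simp)
      (by simp; linarith) (by norm_num) ht
    rw [div_le_div_iff₀ (by norm_num) (by linarith)] at this
    nlinarith
  set t := 3 + |y - r (Real.exp 2)| / d with ht
  have hyt : y ≤ r (Real.exp t) := by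
    have h0 : 0 ≤ |y - r (Real.exp 2)| / d := by positivity
    have h1 := hgrow t (by linarith)
    have h2 : (t - 2) * d = d + |y - r (Real.exp 2)| := by
      rw [ht]
      field_simp
      ring
    have := le_abs_self (y - r (Real.exp 2))
    linarith
  have ht1 : 1 ≤ Real.exp t := by
    have h0 : 0 ≤ |y - r (Real.exp 2)| / d := by positivity
    rw [Real.one_le_exp_iff]
    linarith
  obtain ⟨x, hx, rfl⟩ := intermediate_value_Icc ht1
    (hr.continuousOn.mono Set.Icc_subset_Ici_self) ⟨hy, hyt⟩
  exact ⟨x, hx.1, rfl⟩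

theorem IsEntropyWeight.le_invOne (hr : IsEntropyWeight r) {x y : ℝ} (hx : 1 ≤ x)
    (hxy : r x ≤ y) : x ≤ invOne r y := by
  have hy := hr.exists_eq ((hr.strictMonoOn.monotoneOn (by simp) hx hx).trans hxy)
  have h1 : invOne r y ∈ Set.Ici 1 := Function.invFunOn_mem hy
  have h2 : r (invOne r y) = y := Function.invFunOn_eq hy
  rwa [← hr.strictMonoOn.le_iff_le hx h1, h2]

theorem mul_le_integral_of_forall_ge {f : ℝ → ℝ} {a b c : ℝ} (hab : a ≤ b)
    (hf : IntervalIntegrable f volume a b) (h : ∀ x ∈ Set.Ioo a b, c ≤ f x) :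
    (b - a) * c ≤ ∫ x in a..b, f x := by
  have := intervalIntegral.integral_mono_on_of_le_Ioo hab
    (intervalIntegrable_const (c := c)) hf h
  simpa using this

/-- The number `β p (1-p) p^k` is the length of the interval from `β p^(k+2)` to `β p^(k+1)`, on
which the antitone integrand is at least its right-end value. The integral near 0 is kept to pay for
the leftover weight `p^m`. -/
theorem sum_add_integral_entropyIntegrand_le [CompactSpace B] [Nonempty B]
    (hσ : StrictMonoOn σ (Set.Ioi 0)) (hr : IsEntropyWeight r) (hβ : 0 < β)
    (hdom : Set.Ioo 0 β ⊆ σ '' Set.Ioi 0)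
    (hent : IntervalIntegrable (entropyIntegrand B r σ) volume 0 β) (hp : p ∈ Set.Ioo (0 : ℝ) 1)
    (m : ℕ) :
    (β * p) * ∑ k ∈ Finset.range m,
        ((1 - p) * p ^ k) * entropyIntegrand B r σ (β * p ^ (k + 1)) +
      ∫ u in (0 : ℝ)..(β * p ^ (m + 1)), entropyIntegrand B r σ u ≤
      ∫ u in (0 : ℝ)..(β * p), entropyIntegrand B r σ u := by
  have hp0 := hp.1
  have hp1 := hp.2
  have hlt : ∀ k : ℕ, β * p ^ (k + 1) < β := fun k =>
    mul_lt_of_lt_one_right hβ (pow_lt_one₀ hp0.le hp1 (by simp))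
  induction m with
  | zero => simp
  | succ m ih =>
    refine le_trans ?_ ih
    have hle : β * p ^ (m + 1 + 1) ≤ β * p ^ (m + 1) := by
      gcongr ?_ * ?_
      exact pow_le_pow_of_le_one hp0.le hp1.le (by simp)
    have hi1 : IntervalIntegrable (entropyIntegrand B r σ) volume 0 (β * p ^ (m + 1 + 1)) :=
      hent.mono_set (by
        rw [Set.uIcc_of_le (by positivity), Set.uIcc_of_le hβ.le]
        exact Set.Icc_subset_Icc_right (hlt _).le)
    have hi2 : IntervalIntegrable (entropyIntegrand B r σ) volume (β * p ^ (m + 1 + 1))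
        (β * p ^ (m + 1)) :=
      hent.mono_set (by
        rw [Set.uIcc_of_le hle, Set.uIcc_of_le hβ.le]
        exact Set.Icc_subset_Icc (by positivity) (hlt _).le)
    have hmem : ∀ x, 0 < x → x ≤ β * p ^ (m + 1) → x ∈ σ '' Set.Ioi 0 := fun x h0 h1 =>
      hdom ⟨h0, h1.trans_lt (hlt _)⟩
    have hlow := mul_le_integral_of_forall_ge
      (c := entropyIntegrand B r σ (β * p ^ (m + 1))) hle hi2 fun x hx => by
        have hx0 : 0 < x := lt_trans (by positivity) hx.1
        exact entropyIntegrand_anti hσ hr (hmem x hx0 hx.2.le)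
          (hmem _ (by positivity) le_rfl) hx.2.le
    rw [← intervalIntegral.integral_add_adjacent_intervals hi1 hi2, Finset.sum_range_succ]
    have : β * p * ((1 - p) * p ^ m * entropyIntegrand B r σ (β * p ^ (m + 1))) =
      (β * p ^ (m + 1) - β * p ^ (m + 1 + 1)) * entropyIntegrand B r σ (β * p ^ (m + 1)) := by
      ring
    rw [mul_add, this]
    linarith

theorem sum_geometric_weights (p : ℝ) (m : ℕ) :
    ∑ k ∈ Finset.range m, (1 - p) * p ^ k + p ^ m = 1 := by
  induction m with
  | zero => simp
  | succ m ih => rw [Finset.sum_range_succ]; linear_combination ih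

/-- The geometric mean of the massivenesses along a chain is at most the entropy factor. -/
theorem exp_sum_log_massiveness_le [CompactSpace B] [Nonempty B]
    (hσ : StrictMonoOn σ (Set.Ioi 0)) (hr : IsEntropyWeight r) (hβ : 0 < β)
    (hdom : Set.Ioo 0 β ⊆ σ '' Set.Ioi 0)
    (hent : IntervalIntegrable (entropyIntegrand B r σ) volume 0 β) (hp : p ∈ Set.Ioo (0 : ℝ) 1)
    (m : ℕ) :
    Real.exp (∑ k ∈ Finset.range m,
      ((1 - p) * p ^ k) * Real.log (massiveness B (invPos σ (β * p ^ (k + 1))))) ≤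
      entropyFactor B r σ β p := by
  have hp0 := hp.1
  have hp1 := hp.2
  have hlt : ∀ k : ℕ, β * p ^ (k + 1) < β := fun k =>
    mul_lt_of_lt_one_right hβ (pow_lt_one₀ hp0.le hp1 (by simp))
  have hmem : ∀ k : ℕ, β * p ^ (k + 1) ∈ σ '' Set.Ioi 0 := fun k =>
    hdom ⟨by positivity, hlt k⟩
  have hN : ∀ k : ℕ, (1 : ℝ) ≤ massiveness B (invPos σ (β * p ^ (k + 1))) := fun k => by
    exact_mod_cast one_le_massiveness (invPos_pos (hmem k))
  have hlog : ∀ k : ℕ, 0 ≤ Real.log (massiveness B (invPos σ (β * p ^ (k + 1)))) := fun k =>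
    Real.log_nonneg (hN k)
  have hw : ∀ k : ℕ, 0 ≤ (1 - p) * p ^ k := fun k =>
    mul_nonneg (sub_nonneg.2 hp1.le) (by positivity)
  refine hr.le_invOne (Real.one_le_exp (Finset.sum_nonneg fun k _ => mul_nonneg (hw k) (hlog k))) ?_
  -- An extra point 0 of weight `p^m` completes the weights to total 1; its cost `p^m * r 1` is
  -- covered by the integral over `(0, β p^(m+1))`.
  have hJ := hr.map_exp_sum_le (Finset.range (m + 1))
    (w := fun k => if k = m then p ^ m else (1 - p) * p ^ k)
    (x := fun k => if k = m then 0 else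
      Real.log (massiveness B (invPos σ (β * p ^ (k + 1)))))
    (fun k _ => by split_ifs; exacts [by positivity, hw k])
    (by
      rw [Finset.sum_range_succ, if_pos rfl]
      refine Eq.trans ?_ (sum_geometric_weights p m)
      congr 1
      exact Finset.sum_congr rfl fun k hk => if_neg (Finset.mem_range.1 hk).ne)
    (fun k _ => by split_ifs; exacts [le_rfl, hlog k])
  rw [Finset.sum_range_succ, Finset.sum_range_succ] at hJ
  simp only [if_true, mul_zero, add_zero, Real.exp_zero] at hJ
  have hJ' : r (Real.exp (∑ k ∈ Finset.range m,
      ((1 - p) * p ^ k) * Real.log (massiveness B (invPos σ (β * p ^ (k + 1)))))) ≤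
      ∑ k ∈ Finset.range m, ((1 - p) * p ^ k) * entropyIntegrand B r σ (β * p ^ (k + 1)) +
        p ^ m * r 1 := by
    convert hJ using 3
    · refine Finset.sum_congr rfl fun k hk => ?_
      simp only [if_neg (Finset.mem_range.1 hk).ne]
    · rename_i k hk
      simp only [if_neg (Finset.mem_range.1 hk).ne, entropyIntegrand]
      rw [Real.exp_log (by linarith [hN k])]
  refine hJ'.trans ?_
  have hint := sum_add_integral_entropyIntegrand_le hσ hr hβ hdom hent hp m
  have hlast := mul_le_integral_of_forall_ge (a := 0) (b := β * p ^ (m + 1)) (c := r 1)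
    (f := entropyIntegrand B r σ) (by positivity)
    (hent.mono_set (by
        rw [Set.uIcc_of_le (by positivity), Set.uIcc_of_le hβ.le]
        exact Set.Icc_subset_Icc_right (hlt _).le))
    fun x hx => le_entropyIntegrand hr (hdom ⟨hx.1, hx.2.trans (hlt _)⟩)
  rw [one_div, ← div_eq_inv_mul, le_div_iff₀ (by positivity)]
  calc _ = β * p * ∑ k ∈ Finset.range m,
        ((1 - p) * p ^ k) * entropyIntegrand B r σ (β * p ^ (k + 1)) +
          (β * p ^ (m + 1) - 0) * r 1 := by ring
    _ ≤ _ := by linarith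

end Entropy

/-! ### Chaining with weighted Hölder. -/

section Chaining

variable {Ω : Type*} [MeasurableSpace Ω] {P : Measure Ω} {φ : ℝ → ℝ} {B : Type*}

/-- `∑_{s ∈ V} (exp (c D_s) + exp (-c D_s))`, a smooth substitute for `exp (c max_{s ∈ V} |D_s|)`. -/
noncomputable def twoSidedExpSum (V : Finset B) (D : B → Ω → ℝ) (c : ℝ) (ω : Ω) : ℝ≥0∞ :=
  ∑ s ∈ V, (ENNReal.ofReal (Real.exp (c * D s ω)) + ENNReal.ofReal (Real.exp (-c * D s ω)))

theorem measurable_twoSidedExpSum {V : Finset B} {D : B → Ω → ℝ} (hD : ∀ s, Measurable (D s))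
    (c : ℝ) : Measurable (twoSidedExpSum V D c) := by
  unfold twoSidedExpSum
  exact Finset.measurable_sum _ fun s _ => by
    have := hD s
    fun_prop

omit [MeasurableSpace Ω] in
theorem ofReal_exp_abs_le_twoSidedExpSum {V : Finset B} (D : B → Ω → ℝ) (c : ℝ) (ω : Ω) {s : B}
    (hs : s ∈ V) : ENNReal.ofReal (Real.exp (c * |D s ω|)) ≤ twoSidedExpSum V D c ω := by
  refine le_trans ?_ (Finset.single_le_sum (f := fun s => ENNReal.ofReal (Real.exp (c * D s ω)) +
    ENNReal.ofReal (Real.exp (-c * D s ω))) (fun _ _ => zero_le) hs)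
  rcases abs_choice (D s ω) with h | h <;> rw [h]
  · exact le_self_add
  · rw [mul_neg, ← neg_mul]
    exact le_add_self

theorem lintegral_twoSidedExpSum_le (hφ : IsOrliczNFunction φ) {V : Finset B} {D : B → Ω → ℝ}
    (hD : ∀ s, Measurable (D s)) {τ : ℝ} (h : ∀ s ∈ V, PhiBound φ P (D s) τ) (c : ℝ) :
    ∫⁻ ω, twoSidedExpSum V D c ω ∂P ≤ ENNReal.ofReal (V.card * (2 * Real.exp (φ (τ * c)))) := by
  unfold twoSidedExpSum
  rw [lintegral_finsetSum _ fun s _ => by have := hD s; fun_prop]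
  calc _ ≤ ∑ s ∈ V, ENNReal.ofReal (2 * Real.exp (φ (τ * c))) := by
        refine Finset.sum_le_sum fun s hs => ?_
        rw [lintegral_add_left (by have := hD s; fun_prop), two_mul,
          ENNReal.ofReal_add (Real.exp_pos _).le (Real.exp_pos _).le]
        refine add_le_add (h s hs c) ((h s hs (-c)).trans_eq ?_)
        rw [mul_neg, hφ.even]
    _ = _ := by
        rw [Finset.sum_const, nsmul_eq_mul, ENNReal.ofReal_mul (Nat.cast_nonneg _),
          ENNReal.ofReal_natCast]

/-- Increments along a chain: at level `0` the value itself, afterwards the difference to the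
value at the projection to the previous level. -/
def chainIncrement (Y : B → Ω → ℝ) (π : ℕ → B → B) : ℕ → B → Ω → ℝ
  | 0, s, ω => Y s ω
  | k + 1, s, ω => Y s ω - Y (π k s) ω

theorem measurable_chainIncrement {Y : B → Ω → ℝ} (hY : ∀ s, Measurable (Y s)) (π : ℕ → B → B)
    (k : ℕ) (s : B) : Measurable (chainIncrement Y π k s) := by
  cases k with
  | zero => exact hY s
  | succ k => exact (hY s).sub (hY (π k s))

-- Triangle inequality along the projections of `t`. Each factor is raised to the power `w j` with
-- `l` divided by `w j`, ready for Hölder; the increment at `t` itself stays free until `t` is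
-- restricted to the last net.
omit [MeasurableSpace Ω] in
theorem ofReal_exp_abs_le_chain (Y : B → Ω → ℝ) {π : ℕ → B → B} {V : ℕ → Finset B} {w : ℕ → ℝ}
    {l : ℝ} (hl : 0 ≤ l) (ω : Ω) (k : ℕ) (hw : ∀ j < k, 0 < w j) (hπ : ∀ j < k, ∀ t, π j t ∈ V j)
    (t : B) :
    ENNReal.ofReal (Real.exp (l * |Y t ω|)) ≤
      ENNReal.ofReal (Real.exp (l * |chainIncrement Y π k t ω|)) *
        ∏ j ∈ Finset.range k, twoSidedExpSum (V j) (chainIncrement Y π j) (l / w j) ω ^ w j := by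
  induction k generalizing t with
  | zero => simp [chainIncrement]
  | succ k ih =>
    have hwk := hw k (by simp)
    have h1 := ih (fun j hj => hw j (by omega)) (fun j hj => hπ j (by omega)) (π k t)
    have h2 : ENNReal.ofReal (Real.exp (l * |chainIncrement Y π k (π k t) ω|)) ≤
        twoSidedExpSum (V k) (chainIncrement Y π k) (l / w k) ω ^ w k := by
      have := ENNReal.rpow_le_rpow (ofReal_exp_abs_le_twoSidedExpSum (chainIncrement Y π k)
        (l / w k) ω (hπ k (by simp) t)) hwk.le
      rwa [ofReal_exp_rpow, div_mul_eq_mul_div, div_mul_cancel₀ _ hwk.ne'] at this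
    rw [Finset.prod_range_succ]
    calc ENNReal.ofReal (Real.exp (l * |Y t ω|))
        ≤ ENNReal.ofReal (Real.exp (l * |chainIncrement Y π (k + 1) t ω|)) *
            ENNReal.ofReal (Real.exp (l * |Y (π k t) ω|)) := by
          rw [← ENNReal.ofReal_mul (Real.exp_pos _).le, ← Real.exp_add, ← mul_add]
          refine ENNReal.ofReal_le_ofReal (Real.exp_le_exp.2 (mul_le_mul_of_nonneg_left ?_ hl))
          have := abs_add_le (Y t ω - Y (π k t) ω) (Y (π k t) ω)
          rwa [sub_add_cancel] at this
      _ ≤ _ := by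
          rw [mul_comm (∏ j ∈ Finset.range k, _)]
          gcongr
          exact h1.trans (by gcongr)

/-- As the weights sum to 1, the factors 2 from all levels combine into a single 2. -/
theorem ofReal_prod_rpow_eq {s : Finset ℕ} {w c x : ℕ → ℝ} (hw : ∑ j ∈ s, w j = 1)
    (hc : ∀ j ∈ s, 0 < c j) :
    ∏ j ∈ s, ENNReal.ofReal (c j * (2 * Real.exp (x j))) ^ w j =
      ENNReal.ofReal (2 * Real.exp (∑ j ∈ s, w j * (Real.log (c j) + x j))) := by
  have h1 : ∀ j ∈ s, ENNReal.ofReal (c j * (2 * Real.exp (x j))) ^ w j =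
      ENNReal.ofReal (Real.exp (w j * (Real.log (c j) + Real.log 2 + x j))) := fun j hj => by
    have : c j * (2 * Real.exp (x j)) = Real.exp (Real.log (c j) + Real.log 2 + x j) := by
      rw [Real.exp_add, Real.exp_add, Real.exp_log (hc j hj), Real.exp_log two_pos, mul_assoc]
    rw [this, ofReal_exp_rpow, mul_comm]
  rw [Finset.prod_congr rfl h1, ← ENNReal.ofReal_prod_of_nonneg fun j _ => (Real.exp_pos _).le,
    ← Real.exp_sum]
  congr 1
  rw [← Real.exp_log two_pos, ← Real.exp_add]
  congr 1
  simp only [mul_add, Finset.sum_add_distrib, ← Finset.sum_mul, hw, Real.exp_log two_pos]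
  ring

/-- The tail bound obtained from a finite chain of nets. -/
theorem measure_exists_lt_abs_le_of_chain [IsProbabilityMeasure P] (hφ : IsOrliczNFunction φ)
    {Y : B → Ω → ℝ} (hY : ∀ t, Measurable (Y t)) {π : ℕ → B → B} {V : ℕ → Finset B}
    {w τ : ℕ → ℝ} (m : ℕ) (hw : ∀ j ≤ m, 0 < w j) (hw1 : ∑ j ∈ Finset.range (m + 1), w j = 1)
    (hV : ∀ j ≤ m, (V j).Nonempty) (hπ : ∀ j < m, ∀ t, π j t ∈ V j)
    (hτ : ∀ j ≤ m, ∀ t ∈ V j, PhiBound φ P (chainIncrement Y π j t) (τ j))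
    {l : ℝ} (hl : 0 ≤ l) (δ : ℝ) :
    P {ω | ∃ t ∈ V m, δ < |Y t ω|} ≤ ENNReal.ofReal (2 * Real.exp (-(l * δ) +
      ∑ j ∈ Finset.range (m + 1), w j * (Real.log (V j).card + φ (τ j * (l / w j))))) := by
  set Z : Ω → ℝ≥0∞ := fun ω => ∏ j ∈ Finset.range (m + 1),
    twoSidedExpSum (V j) (chainIncrement Y π j) (l / w j) ω ^ w j with hZ
  have hmeas : ∀ j, Measurable (twoSidedExpSum (V j) (chainIncrement Y π j) (l / w j)) := fun j =>
    measurable_twoSidedExpSum (measurable_chainIncrement hY π j) _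
  have hZm : Measurable Z := Finset.measurable_fun_prod _ fun j _ => (hmeas j).pow_const _
  have hint : ∫⁻ ω, Z ω ∂P ≤ ENNReal.ofReal (2 * Real.exp
      (∑ j ∈ Finset.range (m + 1), w j * (Real.log (V j).card + φ (τ j * (l / w j))))) := by
    have hmem : ∀ j ∈ Finset.range (m + 1), j ≤ m := fun j hj => by
      simpa [Nat.lt_succ_iff] using hj
    refine (ENNReal.lintegral_prod_norm_pow_le _ (fun j _ => (hmeas j).aemeasurable) hw1
      fun j hj => (hw j (hmem j hj)).le).trans ?_
    rw [← ofReal_prod_rpow_eq hw1 fun j hj => by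
      exact_mod_cast Finset.card_pos.2 (hV j (hmem j hj))]
    refine Finset.prod_le_prod' fun j hj => ENNReal.rpow_le_rpow ?_ (hw j (hmem j hj)).le
    exact lintegral_twoSidedExpSum_le hφ (measurable_chainIncrement hY π j) (hτ j (hmem j hj)) _
  have hsub : {ω | ∃ t ∈ V m, δ < |Y t ω|} ⊆ {ω | ENNReal.ofReal (Real.exp (l * δ)) ≤ Z ω} := by
    rintro ω ⟨t, ht, hδ⟩
    have h1 := ofReal_exp_abs_le_chain Y (V := V) hl ω m (fun j hj => hw j hj.le) hπ t
    have h2 := ENNReal.rpow_le_rpow (ofReal_exp_abs_le_twoSidedExpSum (chainIncrement Y π m)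
        (l / w m) ω ht) (hw m le_rfl).le
    rw [ofReal_exp_rpow, div_mul_eq_mul_div, div_mul_cancel₀ _ (hw m le_rfl).ne'] at h2
    simp only [Set.mem_ofPred_eq, hZ, Finset.prod_range_succ]
    calc ENNReal.ofReal (Real.exp (l * δ)) ≤ ENNReal.ofReal (Real.exp (l * |Y t ω|)) := by
          gcongr
      _ ≤ _ := h1
      _ ≤ _ := by
          rw [mul_comm]
          gcongr
  have hmarkov := mul_meas_ge_le_lintegral (μ := P) hZm (ENNReal.ofReal (Real.exp (l * δ)))
  have hne : ENNReal.ofReal (Real.exp (l * δ)) ≠ 0 := by simp [Real.exp_pos]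
  calc P {ω | ∃ t ∈ V m, δ < |Y t ω|} ≤ P {ω | ENNReal.ofReal (Real.exp (l * δ)) ≤ Z ω} :=
        measure_mono hsub
    _ = ENNReal.ofReal (Real.exp (-(l * δ))) *
          (ENNReal.ofReal (Real.exp (l * δ)) * P {ω | ENNReal.ofReal (Real.exp (l * δ)) ≤ Z ω}) := by
        rw [← mul_assoc, ← ENNReal.ofReal_mul (Real.exp_pos _).le, ← Real.exp_add]
        simp
    _ ≤ _ := by
        refine (mul_le_mul_right (hmarkov.trans hint) _).trans_eq ?_
        rw [← ENNReal.ofReal_mul (Real.exp_pos _).le, Real.exp_add]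
        congr 1
        ring

end Chaining

/-! ### Tail bound on finite sets, passage to `B`, and choice of `l`. -/

section Tail

variable {Ω : Type*} [MeasurableSpace Ω] {P : Measure Ω} [IsProbabilityMeasure P] {φ : ℝ → ℝ}
  {B : Type*}

theorem measure_exists_mem_finset_le [MetricSpace B] [CompactSpace B] [Nonempty B]
    (hφ : IsOrliczNFunction φ) {Y : B → Ω → ℝ} (hY : ∀ t, IsSubPhi φ P (Y t)) {γ : ℝ}
    (hγ : ∀ t, PhiBound φ P (Y t) γ) {σ : ℝ → ℝ} (hσ : IsIncrementModulus φ P Y σ) {β : ℝ}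
    (hβ : 0 < β) (hdom : Set.Ioo 0 β ⊆ σ '' Set.Ioi 0) {r : ℝ → ℝ} (hr : IsEntropyWeight r)
    (hent : IntervalIntegrable (entropyIntegrand B r σ) volume 0 β) {p : ℝ}
    (hp : p ∈ Set.Ioo (0 : ℝ) 1) {l : ℝ} (hl : 0 ≤ l) (δ : ℝ) (F : Finset B) :
    P {ω | ∃ t ∈ F, δ < |Y t ω|} ≤ ENNReal.ofReal (2 * Real.exp (-(l * δ) +
      ((1 - p) * φ (γ * (l / (1 - p))) + p * φ (β * (l / (1 - p))))) *
        entropyFactor B r σ β p) := by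
  classical
  have hp0 := hp.1
  have hp1 : 0 < 1 - p := sub_pos.2 hp.2
  rcases F.eq_empty_or_nonempty with rfl | hF
  · simp
  set u : ℕ → ℝ := fun k => invPos σ (β * p ^ (k + 1)) with hu
  have hmem : ∀ k : ℕ, β * p ^ (k + 1) ∈ σ '' Set.Ioi 0 := fun k =>
    hdom ⟨by positivity, mul_lt_of_lt_one_right hβ (pow_lt_one₀ hp0.le hp.2 (by simp))⟩
  have hu0 : ∀ k, 0 < u k := fun k => invPos_pos (hmem k)
  choose V hV hcov using fun k => exists_net_card_eq_massiveness (B := B) (hu0 k)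
  choose π hπ hdist using hcov
  have hlog : ∀ k, Real.log (V k).card = Real.log (massiveness B (u k)) := fun k => by rw [hV]
  have hbound : ∀ m : ℕ, P {ω | ∃ t ∈ F, δ < |Y t ω|} ≤ ENNReal.ofReal (2 * Real.exp (-(l * δ) +
      ((1 - p) * φ (γ * (l / (1 - p))) + p * φ (β * (l / (1 - p))))) *
        entropyFactor B r σ β p * Real.exp (p ^ (m + 1) * Real.log F.card)) := fun m => by
    -- The finite set `F` replaces the net at level `m + 1` and takes all the remaining weight
    -- `p^(m+1)`.
    have hchain := measure_exists_lt_abs_le_of_chain hφ (fun t => (hY t).1) (π := π)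
      (V := fun j => if j = m + 1 then F else V j)
      (w := fun j => if j = m + 1 then p ^ (m + 1) else (1 - p) * p ^ j)
      (τ := fun j => if j = 0 then γ else β * p ^ j) (m + 1)
      (fun j _ => by split_ifs <;> positivity)
      (by
        rw [Finset.sum_range_succ, if_pos rfl]
        refine Eq.trans ?_ (sum_geometric_weights p (m + 1))
        congr 1
        exact Finset.sum_congr rfl fun k hk => if_neg (Finset.mem_range.1 hk).ne)
      (fun j _ => by
        split_ifs
        exacts [hF, ⟨_, hπ j (Classical.arbitrary B)⟩])
      (fun j hj t => by rw [if_neg hj.ne]; exact hπ j t)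
      (fun j _ t _ => by
        cases j with
        | zero => exact hγ t
        | succ k =>
          have h1 : IsSubPhi φ P (fun ω => Y t ω - Y (π k t) ω) := (hY t).sub hφ (hY _)
          have h2 := hσ.bound (u k) (hu0 k) t (π k t) (hdist k t)
          rw [map_invPos (hmem k)] at h2
          exact (h1.phiBound hφ).mono hφ subPhiStandard_nonneg (by simpa using h2)) hl δ
    simp only [if_true] at hchain
    refine hchain.trans (ENNReal.ofReal_le_ofReal ?_)
    have hE := exp_sum_log_massiveness_le hσ.strictMonoOn hr hβ hdom hent hp (m + 1)
    rw [mul_assoc, mul_assoc]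
    refine mul_le_mul_of_nonneg_left ?_ zero_le_two
    set Φγ := φ (γ * (l / (1 - p)))
    set Φβ := φ (β * (l / (1 - p))) with hΦβ
    have hsum : ∑ j ∈ Finset.range (m + 1 + 1), (if j = m + 1 then p ^ (m + 1) else (1 - p) * p ^ j)
        * (Real.log (if j = m + 1 then F else V j).card +
          φ ((if j = 0 then γ else β * p ^ j) *
            (l / if j = m + 1 then p ^ (m + 1) else (1 - p) * p ^ j))) ≤
        ((1 - p) * Φγ + p * Φβ) + (∑ k ∈ Finset.range (m + 1),
          ((1 - p) * p ^ k) * Real.log (massiveness B (invPos σ (β * p ^ (k + 1)))) +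
          p ^ (m + 1) * Real.log F.card) := by
      rw [Finset.sum_range_succ]
      simp only [if_true, Nat.succ_ne_zero, if_false]
      -- The last weight lacks the factor `1 - p`, so the argument is `β l`, at most `β l / (1-p)`.
      have hlast : φ (β * p ^ (m + 1) * (l / p ^ (m + 1))) ≤ Φβ := by
        rw [show β * p ^ (m + 1) * (l / p ^ (m + 1)) = β * l by field_simp]
        refine hφ.le_of_abs_le ?_
        rw [abs_of_nonneg (by positivity), abs_of_nonneg (by positivity)]
        refine mul_le_mul_of_nonneg_left ?_ hβ.le
        rw [le_div_iff₀ hp1]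
        nlinarith
      have hmid : ∑ j ∈ Finset.range (m + 1), (if j = m + 1 then p ^ (m + 1) else (1 - p) * p ^ j)
          * (Real.log (if j = m + 1 then F else V j).card +
          φ ((if j = 0 then γ else β * p ^ j) *
            (l / if j = m + 1 then p ^ (m + 1) else (1 - p) * p ^ j))) =
          ∑ k ∈ Finset.range (m + 1), ((1 - p) * p ^ k) * Real.log (massiveness B (u k)) +
          ((1 - p) * Φγ + (∑ k ∈ Finset.range m, (1 - p) * p ^ k) * (p * Φβ)) := by
        rw [Finset.sum_congr rfl (g := fun k => ((1 - p) * p ^ k) * Real.log (massiveness B (u k)) +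
          ((1 - p) * p ^ k) * (if k = 0 then Φγ else Φβ)) fun k hk => ?_, Finset.sum_add_distrib]
        · rw [Finset.sum_range_succ' (fun k => ((1 - p) * p ^ k) * (if k = 0 then Φγ else Φβ)),
            Finset.sum_mul]
          simp only [if_true, Nat.succ_ne_zero, if_false, pow_zero, mul_one]
          rw [add_comm ((1 - p) * Φγ)]
          congr 2
          exact Finset.sum_congr rfl fun k _ => by ring
        · simp only [if_neg (Finset.mem_range.1 hk).ne]
          rw [mul_add, hlog]
          congr 2
          split_ifs with h0
          · simp [h0, Φγ]
          · rw [hΦβ]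
            congr 1
            field_simp
      rw [hmid]
      have hw := sum_geometric_weights p m
      have hw' : ∑ k ∈ Finset.range m, (1 - p) * p ^ k = 1 - p ^ m := by linarith
      rw [hw']
      have hpm : 0 < p ^ (m + 1) := by positivity
      simp only [hu]
      have hpΦ : p ^ m * (p * Φβ) = p ^ (m + 1) * Φβ := by ring
      linarith [mul_le_mul_of_nonneg_left hlast hpm.le]
    calc _ ≤ Real.exp (-(l * δ) + ((1 - p) * Φγ + p * Φβ) + (∑ k ∈ Finset.range (m + 1),
          ((1 - p) * p ^ k) * Real.log (massiveness B (invPos σ (β * p ^ (k + 1)))) +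
          p ^ (m + 1) * Real.log F.card)) := Real.exp_le_exp.2 (by linarith)
      _ ≤ _ := by
          rw [Real.exp_add, Real.exp_add (∑ k ∈ _, _)]
          gcongr
  -- The left side of `hbound` does not depend on `m`; as `m → ∞` the price of `F` disappears.
  have hlim : Tendsto (fun m : ℕ => ENNReal.ofReal (2 * Real.exp (-(l * δ) +
      ((1 - p) * φ (γ * (l / (1 - p))) + p * φ (β * (l / (1 - p))))) *
        entropyFactor B r σ β p * Real.exp (p ^ (m + 1) * Real.log F.card))) atTop
      (𝓝 (ENNReal.ofReal (2 * Real.exp (-(l * δ) +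
      ((1 - p) * φ (γ * (l / (1 - p))) + p * φ (β * (l / (1 - p))))) *
        entropyFactor B r σ β p))) := by
    refine ENNReal.tendsto_ofReal ?_
    have h1 := ((tendsto_pow_atTop_nhds_zero_of_lt_one hp0.le hp.2).comp
      (tendsto_add_atTop_nat 1)).mul_const (Real.log F.card)
    have h2 := (Real.continuous_exp.tendsto _).comp h1
    rw [zero_mul, Real.exp_zero] at h2
    simpa using h2.const_mul (2 * Real.exp (-(l * δ) +
      ((1 - p) * φ (γ * (l / (1 - p))) + p * φ (β * (l / (1 - p))))) *
        entropyFactor B r σ β p)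
  exact ge_of_tendsto' hlim hbound

-- Exceeding `δ` is an open condition, so almost surely it already occurs on the countable
-- separating set, an increasing union of finite sets.
omit [IsProbabilityMeasure P] in
theorem measure_exists_lt_abs_le_of_finset [TopologicalSpace B] {Y : B → Ω → ℝ}
    (hsep : IsSeparableProcess P Y) {δ : ℝ} {c : ℝ≥0∞}
    (h : ∀ F : Finset B, P {ω | ∃ t ∈ F, δ < |Y t ω|} ≤ c) :
    P {ω | ∃ t, δ < |Y t ω|} ≤ c := by
  obtain ⟨S, hS, -, hae⟩ := hsep
  have := hS.to_subtype
  set A : Finset S → Set Ω := fun F => {ω | ∃ t ∈ F, δ < |Y t ω|} with hA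
  have hmono : Monotone A := fun F G hFG ω ⟨t, ht, hω⟩ => ⟨t, hFG ht, hω⟩
  have hle : P (⋃ F, A F) ≤ c := by
    rw [hmono.directed_le.measure_iUnion]
    refine iSup_le fun F => ?_
    refine (measure_mono ?_).trans (h (F.map (Function.Embedding.subtype _)))
    rintro ω ⟨t, ht, hω⟩
    exact ⟨t, by simpa using ht, hω⟩
  refine le_trans (measure_mono_ae ?_) hle
  filter_upwards [hae] with ω hω
  rintro ⟨t, ht⟩
  have hopen : IsOpen {x : ℝ | δ < |x|} := isOpen_lt continuous_const continuous_abs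
  obtain ⟨_, hx, s, hs, rfl⟩ := mem_closure_iff.1 (hω t Set.univ isOpen_univ trivial) _ hopen ht
  exact Set.mem_iUnion.2 ⟨{⟨s, hs.1⟩}, ⟨s, hs.1⟩, by simp, hx⟩

theorem tail_exponent_eq {ζ : ℝ} (hφ : IsClassCI ζ φ) {β γ p δ : ℝ} (hβ : 0 < β) (hγ : 0 < γ)
    (hp : p ∈ Set.Ioo (0 : ℝ) 1)
    (hδ : (γ ^ ζ * (1 - p) + p * β ^ ζ) / ((1 - p) * (min β γ) ^ (ζ - 1)) < δ) :
    ∃ l : ℝ, 0 ≤ l ∧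
      -(l * δ) + ((1 - p) * φ (γ * (l / (1 - p))) + p * φ (β * (l / (1 - p)))) =
        -((ζ - 1) * (δ * (1 - p)) ^ (ζ / (ζ - 1)) /
            (ζ * (γ ^ ζ * (1 - p) + p * β ^ ζ) ^ (1 / (ζ - 1)))) := by
  have hζ := hφ.two_le
  have hp0 := hp.1
  have hp1 : 0 < 1 - p := sub_pos.2 hp.2
  have hζ1 : 0 < ζ - 1 := by linarith
  have hζ0 : 0 < ζ := by linarith
  set A := γ ^ ζ * (1 - p) + p * β ^ ζ with hA
  have hA0 : 0 < A := by positivity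
  set v := min β γ with hv
  have hv0 : 0 < v := lt_min hβ hγ
  have hδ0 : 0 < δ := lt_trans (by positivity) hδ
  -- The minimiser of `-(1-p) c δ + A c^ζ / ζ`; the multiplier will be `l = (1-p) c`.
  set c := (δ * (1 - p) / A) ^ (1 / (ζ - 1)) with hc
  have hc0 : 0 < c := by positivity
  have hcpow : c ^ (ζ - 1) = δ * (1 - p) / A := by
    rw [hc, ← Real.rpow_mul (by positivity), one_div_mul_cancel hζ1.ne', Real.rpow_one]
  -- The threshold on `δ` says exactly `(v c)^(ζ-1) > 1`.
  have hvc : 1 < v * c := by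
    have h1 : 1 < (v * c) ^ (ζ - 1) := by
      rw [Real.mul_rpow hv0.le hc0.le, hcpow, mul_div_assoc', lt_div_iff₀ hA0, one_mul]
      rw [div_lt_iff₀ (by positivity)] at hδ
      linarith
    by_contra hle
    exact absurd (Real.rpow_le_one (by positivity) (not_lt.1 hle) hζ1.le) (not_le.2 h1)
  have hγc : 1 < γ * c := hvc.trans_le (by gcongr; exact min_le_right _ _)
  have hβc : 1 < β * c := hvc.trans_le (by gcongr; exact min_le_left _ _)
  refine ⟨(1 - p) * c, by positivity, ?_⟩
  rw [mul_div_cancel_left₀ _ hp1.ne', hφ.eq_of_one_lt _ hγc, hφ.eq_of_one_lt _ hβc,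
    Real.mul_rpow hγ.le hc0.le, Real.mul_rpow hβ.le hc0.le]
  have hcζ : c ^ ζ = c * (δ * (1 - p) / A) := by
    rw [← hcpow, ← Real.rpow_one_add' hc0.le (by linarith)]
    congr 1
    ring
  have hpow : (δ * (1 - p)) ^ (ζ / (ζ - 1)) = (δ * (1 - p)) * c * A ^ (1 / (ζ - 1)) := by
    rw [hc, Real.div_rpow (by positivity) hA0.le, mul_assoc, div_mul_cancel₀ _ (by positivity),
      ← Real.rpow_one_add' (by positivity) (by positivity)]
    congr 1
    field_simp
    ring
  rw [hpow, hcζ]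
  have hAr : A ^ (1 / (ζ - 1)) ≠ 0 := by positivity
  calc _ = -((1 - p) * c * δ) + A * (c * (δ * (1 - p) / A)) / ζ := by rw [hA]; ring
    _ = _ := by
      field_simp
      ring

end Tail

/-! ### Separability of the error process. -/

section Separability

variable {Ω : Type*} [MeasurableSpace Ω] {P : Measure Ω} {φ : ℝ → ℝ} {B : Type*}

theorem PhiBound.abs_mul_subPhiStandard_le (hφ : IsOrliczNFunction φ) {ξ : Ω → ℝ} {a c : ℝ}
    (ha : 0 ≤ a) (h : PhiBound φ P (fun ω => c * ξ ω) a) : |c| * subPhiStandard φ P ξ ≤ a := by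
  rcases eq_or_ne c 0 with rfl | hc
  · simpa using ha
  have h1 := h.const_mul hφ c⁻¹
  simp only [inv_mul_cancel_left₀ hc] at h1
  have h2 := subPhiStandard_le (by positivity) h1
  rwa [abs_inv, ← div_eq_inv_mul, le_div_iff₀' (abs_pos.2 hc)] at h2

theorem IsIncrementModulus.nonneg [MetricSpace B] [Nonempty B] {Y : B → Ω → ℝ} {σ : ℝ → ℝ}
    (hσ : IsIncrementModulus φ P Y σ) {h : ℝ} (hh : 0 < h) : 0 ≤ σ h := by
  have t := Classical.arbitrary B
  exact subPhiStandard_nonneg.trans (hσ.bound h hh t t (by simpa using hh.le))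

theorem IsIncrementModulus.pos [MetricSpace B] [Nonempty B] {Y : B → Ω → ℝ} {σ : ℝ → ℝ}
    (hσ : IsIncrementModulus φ P Y σ) {h : ℝ} (hh : 0 < h) : 0 < σ h :=
  (hσ.nonneg (half_pos hh)).trans_lt
    (hσ.strictMonoOn (half_pos hh) hh (half_lt_self hh))

theorem IsIncrementModulus.phiBound_sub [MetricSpace B] (hφ : IsOrliczNFunction φ)
    {Y : B → Ω → ℝ} {σ : ℝ → ℝ} (hσ : IsIncrementModulus φ P Y σ) (hY : ∀ t, IsSubPhi φ P (Y t))
    {h : ℝ} (hh : 0 < h) {t s : B} (hts : dist t s ≤ h) :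
    PhiBound φ P (fun ω => Y t ω - Y s ω) (σ h) :=
  (((hY t).sub hφ (hY s)).phiBound hφ).mono hφ subPhiStandard_nonneg (hσ.bound h hh t s hts)

theorem isSubPhi_errorProcess [IsProbabilityMeasure P] (hφ : IsOrliczNFunction φ)
    {X : B → Ω → ℝ} (hX : ∀ t, IsSubPhi φ P (X t)) {ξ : ℕ → Ω → ℝ}
    (hξ : ∀ k, IsSubPhi φ P (ξ k)) (ahat : ℕ → B → ℝ) (N : ℕ) (t : B) :
    IsSubPhi φ P (errorProcess X ahat ξ N t) :=
  (hX t).sub hφ (.sum hφ _ fun k _ => (hξ k).const_mul hφ (ahat k t))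

/-- The coefficients of the nondegenerate terms of the model are continuous if the process and
the error process are continuous in the standard. -/
theorem continuous_coefficient_of_isIncrementModulus [IsProbabilityMeasure P] [MetricSpace B]
    (hφ : IsOrliczNFunction φ) {X : B → Ω → ℝ} (hX : ∀ t, IsSubPhi φ P (X t)) {ξ : ℕ → Ω → ℝ}
    (hξ : ∀ k, IsSubPhi φ P (ξ k)) (hind : iIndepFun ξ P) {ahat : ℕ → B → ℝ} {N : ℕ}
    {σ σN : ℝ → ℝ} (hσ : IsIncrementModulus φ P X σ)
    (hσN : IsIncrementModulus φ P (errorProcess X ahat ξ N) σN) {k : ℕ} (hk : k < N)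
    (hτ : 0 < subPhiStandard φ P (ξ k)) : Continuous (ahat k) := by
  rw [Metric.continuous_iff']
  intro t ε hε
  have : Nonempty B := ⟨t⟩
  have hlim : Tendsto (fun h => σ h + σN h) (𝓝[>] 0) (𝓝 0) := by
    simpa using hσ.tendsto_zero.add hσN.tendsto_zero
  obtain ⟨h, hh, hh0⟩ := ((hlim.eventually_lt_const (mul_pos hε hτ)).and
    self_mem_nhdsWithin).exists
  filter_upwards [Metric.closedBall_mem_nhds t hh0] with s hs
  -- The model is `X` minus the error, so its increments have standard at most `σ h + σN h`.
  -- Dropping all terms but the `k`-th then controls the increment of `ahat k`.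
  have hb := (hσ.phiBound_sub hφ hX hh0 hs).add hφ
    ((hX s).sub hφ (hX t)).1
    (((isSubPhi_errorProcess hφ hX hξ ahat N s).sub hφ
      (isSubPhi_errorProcess hφ hX hξ ahat N t)).1.const_mul (-1))
    (hσ.nonneg hh0) (by simpa using hσN.nonneg hh0)
    ((hσN.phiBound_sub hφ (isSubPhi_errorProcess hφ hX hξ ahat N) hh0 hs).const_mul hφ (-1))
  have hfun : (fun ω => X s ω - X t ω +
      -1 * (errorProcess X ahat ξ N s ω - errorProcess X ahat ξ N t ω)) =
      fun ω => ∑ i ∈ Finset.range N, (ahat i s - ahat i t) * ξ i ω := by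
    funext ω
    simp only [errorProcess, model, sub_mul, Finset.sum_sub_distrib]
    ring
  rw [hfun] at hb
  have h1 := (hb.of_sum hφ hξ hind (Finset.mem_range.2 hk)).abs_mul_subPhiStandard_le hφ
    (add_nonneg (hσ.nonneg hh0) (by simpa using hσN.nonneg hh0))
  rw [abs_neg, abs_one, one_mul] at h1
  rw [Real.dist_eq]
  exact lt_of_mul_lt_mul_right (h1.trans_lt hh) hτ.le

theorem isSeparableProcess_sub_of_ae_continuous [TopologicalSpace B] {X Y : B → Ω → ℝ}
    (hX : IsSeparableProcess P X) (hY : ∀ᵐ ω ∂P, Continuous fun t => Y t ω) :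
    IsSeparableProcess P fun t ω => X t ω - Y t ω := by
  obtain ⟨S, hS, hd, hae⟩ := hX
  refine ⟨S, hS, hd, ?_⟩
  filter_upwards [hae, hY] with ω hω hc t U hU ht
  rw [Metric.mem_closure_iff]
  intro ε hε
  have hopen : IsOpen {s | dist (Y s ω) (Y t ω) < ε / 2} :=
    isOpen_lt (hc.dist continuous_const) continuous_const
  obtain ⟨_, ⟨s, ⟨hsS, hsU, hs⟩, rfl⟩, hdist⟩ := Metric.mem_closure_iff.1
    (hω t (U ∩ {s | dist (Y s ω) (Y t ω) < ε / 2}) (hU.inter hopen)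
      ⟨ht, by simpa using hε⟩) (ε / 2) (half_pos hε)
  refine ⟨_, ⟨s, ⟨hsS, hsU⟩, rfl⟩, ?_⟩
  refine (dist_sub_sub_le _ _ _ _).trans_lt ?_
  have hs' : dist (Y t ω) (Y s ω) < ε / 2 := by rw [dist_comm]; exact hs
  linarith

theorem isSeparableProcess_errorProcess [IsProbabilityMeasure P] [MetricSpace B]
    (hφ : IsOrliczNFunction φ) {X : B → Ω → ℝ} (hX : ∀ t, IsSubPhi φ P (X t)) {ξ : ℕ → Ω → ℝ}
    (hξ : ∀ k, IsSubPhi φ P (ξ k)) (hind : iIndepFun ξ P) {ahat : ℕ → B → ℝ} {N : ℕ}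
    {σ σN : ℝ → ℝ} (hσ : IsIncrementModulus φ P X σ)
    (hσN : IsIncrementModulus φ P (errorProcess X ahat ξ N) σN) (hsep : IsSeparableProcess P X) :
    IsSeparableProcess P (errorProcess X ahat ξ N) := by
  refine isSeparableProcess_sub_of_ae_continuous hsep ?_
  -- Coefficients of degenerate `ξ k` may be discontinuous, but those terms vanish almost surely.
  have hae : ∀ᵐ ω ∂P, ∀ k, subPhiStandard φ P (ξ k) = 0 → ξ k ω = 0 := by
    rw [ae_all_iff]
    intro k
    by_cases hk : subPhiStandard φ P (ξ k) = 0
    · have := (hξ k).phiBound hφ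
      rw [hk] at this
      filter_upwards [this.ae_eq_zero hφ (hξ k).1] with ω hω _ using hω
    · exact .of_forall fun ω h => absurd h hk
  filter_upwards [hae] with ω hω
  refine continuous_finsetSum _ fun k hk => ?_
  rcases eq_or_lt_of_le (subPhiStandard_nonneg (φ := φ) (P := P) (ξ := ξ k)) with h | h
  · simp only [hω k h.symm, mul_zero]
    exact continuous_const
  · exact (continuous_coefficient_of_isIncrementModulus hφ hX hξ hind hσ hσN
      (Finset.mem_range.1 hk) h).mul_const _

end Separability

/-! ### Standards of independent sums and mean-square limits. -/

section SeriesBound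

variable {Ω : Type*} [MeasurableSpace Ω] {P : Measure Ω} {φ : ℝ → ℝ}

/-- Convexity between 0 and the total `S` gives `ψ (x i) ≤ (x i / S) ψ S`; these add up. -/
theorem sum_le_map_sum_of_convexOn {ψ : ℝ → ℝ} (hψ : ConvexOn ℝ Set.univ ψ) (h0 : ψ 0 = 0)
    {ι : Type*} (s : Finset ι) {x : ι → ℝ} (hx : ∀ i ∈ s, 0 ≤ x i) :
    ∑ i ∈ s, ψ (x i) ≤ ψ (∑ i ∈ s, x i) := by
  set S := ∑ i ∈ s, x i with hS
  rcases (Finset.sum_nonneg hx).eq_or_lt with h | h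
  · have hz := (Finset.sum_eq_zero_iff_of_nonneg hx).1 h.symm
    rw [Finset.sum_eq_zero fun i hi => by rw [hz i hi, h0], hS, ← h, h0]
  · replace h : 0 < S := h
    have hstar : ∀ i ∈ s, ψ (x i) ≤ x i / S * ψ S := fun i hi => by
      have hle : x i / S ≤ 1 := (div_le_one h).2 (Finset.single_le_sum hx hi)
      have := hψ.2 (Set.mem_univ S) (Set.mem_univ 0) (div_nonneg (hx i hi) h.le)
        (sub_nonneg.2 hle) (by ring)
      simpa only [smul_eq_mul, mul_zero, add_zero, h0, div_mul_cancel₀ _ h.ne'] using this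
    calc _ ≤ ∑ i ∈ s, x i / S * ψ S := Finset.sum_le_sum hstar
      _ = ψ S := by rw [← Finset.sum_mul, ← Finset.sum_div, div_self h.ne', one_mul]

/-- The standard of a sum of independent variables when `φ (√|x|)` is convex. -/
theorem phiBound_sum_of_iIndepFun (hφ : IsOrliczNFunction φ)
    (hconv : ConvexOn ℝ Set.univ fun x : ℝ => φ (|x| ^ (1 / 2 : ℝ))) {ι : Type*}
    {ξ : ι → Ω → ℝ} (hξ : ∀ i, IsSubPhi φ P (ξ i)) (hind : iIndepFun ξ P) (s : Finset ι)
    (c : ι → ℝ) :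
    PhiBound φ P (fun ω => ∑ i ∈ s, c i * ξ i ω)
      (√(∑ i ∈ s, subPhiStandard φ P (ξ i) ^ 2 * |c i| ^ 2)) := fun l => by
  rw [lintegral_exp_sum_eq_prod (fun i => (hξ i).1) hind]
  have hsq : ∀ y : ℝ, φ (|y ^ 2| ^ (1 / 2 : ℝ)) = φ y := fun y => by
    rw [← Real.sqrt_eq_rpow, abs_of_nonneg (sq_nonneg y), Real.sqrt_sq_eq_abs]
    simpa using hφ.map_abs_mul y 1
  calc _ ≤ ∏ i ∈ s, ENNReal.ofReal (Real.exp (φ (|c i| * subPhiStandard φ P (ξ i) * l))) :=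
        Finset.prod_le_prod' fun i _ => ((hξ i).phiBound hφ).const_mul hφ (c i) l
    _ = ENNReal.ofReal (Real.exp (∑ i ∈ s, φ (|c i| * subPhiStandard φ P (ξ i) * l))) := by
        rw [← ENNReal.ofReal_prod_of_nonneg fun i _ => (Real.exp_pos _).le, ← Real.exp_sum]
    _ ≤ _ := by
        refine ENNReal.ofReal_le_ofReal (Real.exp_le_exp.2 ?_)
        -- Superadditivity of `φ(√|x|)` is applied to the squares of the individual arguments.
        have h1 := sum_le_map_sum_of_convexOn hconv (by simp [hφ.map_zero]) s
          (x := fun i => (|c i| * subPhiStandard φ P (ξ i) * l) ^ 2) fun i _ => sq_nonneg _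
        simp only [hsq] at h1
        refine h1.trans_eq ?_
        rw [← hsq (_ * l), mul_pow, Real.sq_sqrt (Finset.sum_nonneg fun i _ => by positivity),
          Finset.sum_mul]
        congr 3
        exact Finset.sum_congr rfl fun i _ => by ring

/-- Fatou's lemma along an almost surely convergent subsequence. -/
theorem PhiBound.of_tendsto_eLpNorm {f : ℕ → Ω → ℝ} {g : Ω → ℝ} {a : ℝ}
    (hf : ∀ n, Measurable (f n)) (hg : Measurable g) (h : ∀ n, PhiBound φ P (f n) a)
    (hlim : Tendsto (fun n => eLpNorm (fun ω => g ω - f n ω) 2 P) atTop (𝓝 0)) :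
    PhiBound φ P g a := fun l => by
  have hlim' : Tendsto (fun n => eLpNorm (f n - g) 2 P) atTop (𝓝 0) :=
    hlim.congr fun n => eLpNorm_sub_comm g (f n) 2 P
  obtain ⟨ns, -, hns⟩ := (tendstoInMeasure_of_tendsto_eLpNorm two_ne_zero
    (fun n => (hf n).aestronglyMeasurable) hg.aestronglyMeasurable hlim').exists_seq_tendsto_ae
  calc ∫⁻ ω, ENNReal.ofReal (Real.exp (l * g ω)) ∂P
      = ∫⁻ ω, liminf (fun i => ENNReal.ofReal (Real.exp (l * f (ns i) ω))) atTop ∂P := by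
        refine lintegral_congr_ae ?_
        filter_upwards [hns] with ω hω
        exact (ENNReal.tendsto_ofReal
          ((Real.continuous_exp.tendsto _).comp (hω.const_mul l))).liminf_eq.symm
    _ ≤ liminf (fun i => ∫⁻ ω, ENNReal.ofReal (Real.exp (l * f (ns i) ω)) ∂P) atTop :=
        lintegral_liminf_le fun i => by have := hf (ns i); fun_prop
    _ ≤ _ := liminf_le_of_frequently_le' (.of_forall fun i => h (ns i) l)

theorem phiBound_errorProcess_of_convexOn [IsProbabilityMeasure P] (hφ : IsOrliczNFunction φ)
    (hconv : ConvexOn ℝ Set.univ fun x : ℝ => φ (|x| ^ (1 / 2 : ℝ))) {B : Type*}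
    {X : B → Ω → ℝ} (hX : ∀ t, IsSubPhi φ P (X t)) {ξ : ℕ → Ω → ℝ}
    (hξ : ∀ k, IsSubPhi φ P (ξ k)) (hind : iIndepFun ξ P) {a : ℕ → B → ℝ} (ahat : ℕ → B → ℝ)
    (hseries : IsSeriesExpansion P X a ξ) (N : ℕ) {Q : ℝ} (hQ0 : 0 ≤ Q) (t : B)
    (hQ : ∑ k ∈ Finset.range N, ENNReal.ofReal (subPhiStandard φ P (ξ k) ^ 2) *
        ENNReal.ofReal (|a k t - ahat k t| ^ 2) +
      ∑' k : ℕ, ENNReal.ofReal (subPhiStandard φ P (ξ (N + k)) ^ 2) *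
        ENNReal.ofReal (a (N + k) t ^ 2) ≤ ENNReal.ofReal Q) :
    PhiBound φ P (errorProcess X ahat ξ N t) (√Q) := by
  -- The coefficients of the error process in the `ξ k`; its partial sums beyond `N` all satisfy the
  -- bound with `√Q`.
  set b : ℕ → ℝ := fun k => if k < N then a k t - ahat k t else a k t with hb
  have hbN : ∀ k ∈ Finset.range N, b k = a k t - ahat k t := fun k hk =>
    if_pos (Finset.mem_range.1 hk)
  have hbN' : ∀ k, b (N + k) = a (N + k) t := fun k => if_neg (by omega)
  refine PhiBound.of_tendsto_eLpNorm
    (f := fun n ω => ∑ k ∈ Finset.range (N + n), b k * ξ k ω)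
    (fun n => Finset.measurable_fun_sum _ fun k _ => (hξ k).1.const_mul _)
    (isSubPhi_errorProcess hφ hX hξ ahat N t).1 (fun n => ?_) ?_
  · refine (phiBound_sum_of_iIndepFun hφ hconv hξ hind _ b).mono hφ (Real.sqrt_nonneg _)
      (Real.sqrt_le_sqrt ?_)
    rw [← ENNReal.ofReal_le_ofReal_iff hQ0, ENNReal.ofReal_sum_of_nonneg fun i _ => by positivity,
      Finset.sum_range_add]
    refine le_trans (add_le_add (Finset.sum_le_sum fun k hk => ?_) ?_) hQ
    · rw [hbN k hk, ENNReal.ofReal_mul (sq_nonneg _)]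
    · refine le_trans (Finset.sum_le_sum fun k _ => ?_) (ENNReal.sum_le_tsum (Finset.range n))
      rw [hbN', sq_abs, ENNReal.ofReal_mul (sq_nonneg _)]
  · refine ((hseries t).comp (tendsto_add_atTop_nat N)).congr fun n => ?_
    simp only [Function.comp_apply]
    congr 1
    funext ω
    simp only [errorProcess, model, add_comm n N, Finset.sum_range_add, hbN']
    have hsum : ∑ k ∈ Finset.range N, b k * ξ k ω =
        ∑ k ∈ Finset.range N, (a k t - ahat k t) * ξ k ω :=
      Finset.sum_congr rfl fun k hk => by rw [hbN k hk]
    rw [hsum]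
    simp only [sub_mul, Finset.sum_sub_distrib]
    ring

end SeriesBound

/-! ### Positivity of the radius and finiteness of `γ`. -/

section SupStandard

variable {Ω : Type*} [MeasurableSpace Ω] {P : Measure Ω} {φ : ℝ → ℝ} {B : Type*}

theorem radius_pos [MetricSpace B] [CompactSpace B] [Nontrivial B] : 0 < radius B := by
  obtain ⟨x, y, hxy⟩ := exists_pair_ne B
  refine (half_pos (dist_pos.2 hxy)).trans_le (le_ciInf fun s => ?_)
  have hbdd : BddAbove (Set.range fun t => dist t s) :=
    (isCompact_range (continuous_id.dist continuous_const)).bddAbove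
  have hx := le_ciSup hbdd x
  have hy := le_ciSup hbdd y
  have := dist_triangle_right x y s
  linarith

theorem supStandard_nonneg (Y : B → Ω → ℝ) : 0 ≤ supStandard φ P Y :=
  Real.iSup_nonneg fun _ => subPhiStandard_nonneg

theorem subPhiStandard_le_supStandard [MetricSpace B] [CompactSpace B]
    (hφ : IsOrliczNFunction φ) {Y : B → Ω → ℝ} (hY : ∀ t, IsSubPhi φ P (Y t)) {σ : ℝ → ℝ}
    (hσ : IsIncrementModulus φ P Y σ) (t : B) :
    subPhiStandard φ P (Y t) ≤ supStandard φ P Y := by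
  refine le_ciSup (f := fun u => subPhiStandard φ P (Y u)) ?_ t
  -- A real supremum of an unbounded family is 0 by default, so boundedness is needed. The modulus
  -- at the diameter supplies it; the `+ 1` keeps `h` positive.
  set h := Metric.diam (Set.univ : Set B) + 1 with hh
  have hh0 : 0 < h := by positivity
  refine ⟨σ h + subPhiStandard φ P (Y t), ?_⟩
  rintro _ ⟨s, rfl⟩
  have hd : dist s t ≤ h := (Metric.dist_le_diam_of_mem isCompact_univ.isBounded
    (Set.mem_univ s) (Set.mem_univ t)).trans (by simp [hh])
  have h1 := subPhiStandard_add_le hφ ((hY s).sub hφ (hY t)) (hY t)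
  simp only [sub_add_cancel] at h1
  have h2 := hσ.bound h hh0 s t hd
  dsimp only
  linarith

end SupStandard

end PhiSubGaussian

/-! ### Proof of the theorem. -/

theorem theorem9 {Ω : Type*} [MeasurableSpace Ω] (P : Measure Ω) [IsProbabilityMeasure P]
    {B : Type*} [MetricSpace B] [CompactSpace B] [Nontrivial B]
    (ζ : ℝ) (φ : ℝ → ℝ) (hφ : PhiSubGaussian.IsClassCI ζ φ)
    (ξ : ℕ → Ω → ℝ) (hξ : ∀ k, PhiSubGaussian.IsSubPhi φ P (ξ k)) (hind : iIndepFun ξ P)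
    (a ahat : ℕ → B → ℝ) (X : B → Ω → ℝ) (hX : ∀ t, PhiSubGaussian.IsSubPhi φ P (X t))
    (hseries : PhiSubGaussian.IsSeriesExpansion P X a ξ)
    (hsep : PhiSubGaussian.IsSeparableProcess P X)
    (σ : ℝ → ℝ) (hσ : PhiSubGaussian.IsIncrementModulus φ P X σ)
    (N : ℕ) (σN : ℝ → ℝ)
    (hσN : PhiSubGaussian.IsIncrementModulus φ P (PhiSubGaussian.errorProcess X ahat ξ N) σN)
    (β : ℝ)
    (hβ : β = σ (PhiSubGaussian.radius B) ∨ β = σN (PhiSubGaussian.radius B))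
    (hdom : Set.Ioo 0 β ⊆ σN '' Set.Ioi 0)
    (r : ℝ → ℝ) (hr : PhiSubGaussian.IsEntropyWeight r)
    (hent : IntervalIntegrable (PhiSubGaussian.entropyIntegrand B r σN) volume 0 β)
    (γ : ℝ)
    (hγ : γ = PhiSubGaussian.supStandard φ P (PhiSubGaussian.errorProcess X ahat ξ N)) :
    (∀ p ∈ Set.Ioo (0 : ℝ) 1, ∀ δ ν : ℝ,
      (γ ^ ζ * (1 - p) + p * β ^ ζ) / ((1 - p) * (min β γ) ^ (ζ - 1)) < δ →
      2 * Real.exp (-((ζ - 1) * (δ * (1 - p)) ^ (ζ / (ζ - 1)) /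
            (ζ * (γ ^ ζ * (1 - p) + p * β ^ ζ) ^ (1 / (ζ - 1))))) *
          PhiSubGaussian.entropyFactor B r σN β p ≤ ν →
      PhiSubGaussian.Approximates P X (PhiSubGaussian.model ahat ξ N) δ ν) ∧
    (ConvexOn ℝ Set.univ (fun x : ℝ => φ (|x| ^ (1 / 2 : ℝ))) →
      ENNReal.ofReal (γ ^ ζ) ≤
        (∑ k ∈ Finset.range N, ENNReal.ofReal (PhiSubGaussian.subPhiStandard φ P (ξ k) ^ 2) *
              (⨆ u : B, ENNReal.ofReal (|a k u - ahat k u| ^ 2)) +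
          ∑' k : ℕ, ENNReal.ofReal (PhiSubGaussian.subPhiStandard φ P (ξ (N + k)) ^ 2) *
              (⨆ u : B, ENNReal.ofReal (a (N + k) u ^ 2))) ^ (ζ / 2)) := by
  have hO := hφ.isOrlicz
  have hΔ := PhiSubGaussian.isSubPhi_errorProcess hO hX hξ ahat N
  have hβ0 : 0 < β := by
    rcases hβ with rfl | rfl
    exacts [hσ.pos PhiSubGaussian.radius_pos, hσN.pos PhiSubGaussian.radius_pos]
  have hγ0 : 0 ≤ γ := hγ ▸ PhiSubGaussian.supStandard_nonneg _
  have hτγ : ∀ t, PhiSubGaussian.subPhiStandard φ P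
      (PhiSubGaussian.errorProcess X ahat ξ N t) ≤ γ := fun t =>
    hγ ▸ PhiSubGaussian.subPhiStandard_le_supStandard hO hΔ hσN t
  have hbound : ∀ t, PhiSubGaussian.PhiBound φ P (PhiSubGaussian.errorProcess X ahat ξ N t) γ :=
    fun t => ((hΔ t).phiBound hO).mono hO PhiSubGaussian.subPhiStandard_nonneg (hτγ t)
  refine ⟨fun p hp δ ν hδ hν => ?_, fun hconv => ?_⟩
  · refine PhiSubGaussian.measure_exists_lt_abs_le_of_finset
      (PhiSubGaussian.isSeparableProcess_errorProcess hO hX hξ hind hσ hσN hsep) fun F => ?_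
    -- If `γ = 0`, the threshold is a division by 0, hence 0. Then `δ > 0`, while the error vanishes
    -- almost surely on `F`.
    rcases hγ0.eq_or_lt with hγz | hγpos
    · have hδ0 : 0 < δ := by
        have hp1 : 0 < 1 - p := sub_pos.2 hp.2
        have hp0 := hp.1
        have hmin : 0 ≤ min β γ := le_min hβ0.le hγ0
        exact lt_of_le_of_lt (by positivity) hδ
      have hae : ∀ᵐ ω ∂P, ∀ t ∈ F, PhiSubGaussian.errorProcess X ahat ξ N t ω = 0 := by
        refine (Filter.eventually_all_finset F).2 fun t _ => ?_
        exact (hγz ▸ hbound t).ae_eq_zero hO (hΔ t).1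
      refine le_of_eq_of_le (measure_eq_zero_iff_ae_notMem.2 (hae.mono fun ω hω => ?_)) zero_le
      rintro ⟨t, ht, hlt⟩
      rw [hω t ht, abs_zero] at hlt
      exact lt_asymm hlt hδ0
    · obtain ⟨l, hl, hexp⟩ := PhiSubGaussian.tail_exponent_eq hφ hβ0 hγpos hp hδ
      refine (PhiSubGaussian.measure_exists_mem_finset_le hO hΔ hbound hσN hβ0 hdom hr hent hp hl
        δ F).trans (ENNReal.ofReal_le_ofReal ?_)
      rwa [hexp]
  · have hζ0 : 0 < ζ := by linarith [hφ.two_le]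
    set T : ℝ≥0∞ := ∑ k ∈ Finset.range N,
        ENNReal.ofReal (PhiSubGaussian.subPhiStandard φ P (ξ k) ^ 2) *
          (⨆ u : B, ENNReal.ofReal (|a k u - ahat k u| ^ 2)) +
        ∑' k : ℕ, ENNReal.ofReal (PhiSubGaussian.subPhiStandard φ P (ξ (N + k)) ^ 2) *
          (⨆ u : B, ENNReal.ofReal (a (N + k) u ^ 2)) with hT
    rcases eq_or_ne T ⊤ with htop | htop
    · rw [htop, ENNReal.top_rpow_of_pos (by positivity)]
      exact le_top
    have hle : γ ≤ √T.toReal := by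
      rw [hγ]
      refine ciSup_le fun t => PhiSubGaussian.subPhiStandard_le (Real.sqrt_nonneg _)
        (PhiSubGaussian.phiBound_errorProcess_of_convexOn hO hconv hX hξ hind ahat hseries N
          ENNReal.toReal_nonneg t ?_)
      rw [ENNReal.ofReal_toReal htop, hT]
      gcongr with k _ k
      · exact le_iSup (fun u => ENNReal.ofReal (|a k u - ahat k u| ^ 2)) t
      · exact le_iSup (fun u => ENNReal.ofReal (a (N + k) u ^ 2)) t
    calc ENNReal.ofReal (γ ^ ζ) ≤ ENNReal.ofReal (√T.toReal ^ ζ) :=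
          ENNReal.ofReal_le_ofReal (Real.rpow_le_rpow hγ0 hle hζ0.le)
      _ = T ^ (ζ / 2) := by
          rw [Real.sqrt_eq_rpow, ← Real.rpow_mul ENNReal.toReal_nonneg,
            ← ENNReal.ofReal_rpow_of_nonneg ENNReal.toReal_nonneg (by positivity),
            ENNReal.ofReal_toReal htop]
          congr 1
          ring
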